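/- A polygon $P$ with $n$ vertices is \emph{simple} if its vertices are distinct, consecutive edges meet only in their common vertex, and all other pairs of edges are disjoint; it is in \emph{general position} if no three of its vertices are collinear. A \emph{vertex guard} of $P$ is stationed at a vertex $v$ of $P$ and broadcasts a key of its own over an angular cone with apex $v$, that is, to the points $v + r(\cos\varphi,\sin\varphi)$ with $r\ge 0$ and $\varphi$ in a fixed interval of angles (the interval may be open, closed or half-open; $P$ does not block broadcasts; several guards may be stationed at one vertex). A finite family of vertex guards \emph{localizes} $P$ if some monotone Boolean formula, built by AND and OR from the statements ``the point receives the key of guard $i$'', is true at every point of the plane inside $P$ and false at every point outside $P$; nothing is required at points on the boundary of $P$. \textbf{Theorem.} For every $n\ge 3$ there is an $n$-vertex simple polygon $P$ in general position such that every family of vertex guards that localizes $P$ has at least $\lfloor 2n/3\rfloor-1$ members. Moreover the bound survives small perturbations: $P$ can be chosen together with an $\varepsilon>0$ such that every polygon obtained from $P$ by moving each vertex by less than $\varepsilon$ is simple and also requires at least $\lfloor 2n/3\rfloor-1$ vertex guards for localization. -/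

import Mathlib

namespace WirelessLocalization

/-- The Euclidean plane. -/
abbrev Plane : Type := EuclideanSpace ℝ (Fin 2)

/-- A polygon with cyclically ordered vertices is simple if it has at least three vertices, the
vertices are pairwise distinct, consecutive edges meet exactly in their common vertex, and any two
other edges are disjoint. (Edge `i` joins vertex `i` to vertex `finRotate n i`, the cyclic
successor.) -/
structure IsSimple {n : ℕ} (P : Polygon Plane n) : Prop where
  three_le : 3 ≤ n
  injective : Function.Injective P.vertices
  adjacent : ∀ i : Fin n, P.edgeSet ℝ i ∩ P.edgeSet ℝ (finRotate n i) = {P (finRotate n i)}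
  disjoint : ∀ i j : Fin n, i ≠ j → finRotate n i ≠ j → finRotate n j ≠ i →
    Disjoint (P.edgeSet ℝ i) (P.edgeSet ℝ j)

/-- General position: no three distinct vertices are collinear. -/
def InGeneralPosition {n : ℕ} (P : Polygon Plane n) : Prop :=
  ∀ i j k : Fin n, i ≠ j → j ≠ k → i ≠ k → ¬ Collinear ℝ {P i, P j, P k}

/-- The inside of a polygon: the points off the boundary whose connected component in the
complement of the boundary is bounded. -/
def inside {n : ℕ} (P : Polygon Plane n) : Set Plane :=
  {x | x ∉ P.boundary ℝ ∧ Bornology.IsBounded (connectedComponentIn (P.boundary ℝ)ᶜ x)}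

/-- The unit vector in direction `φ` (an angle in radians). -/
noncomputable def direction (φ : ℝ) : Plane := !₂[Real.cos φ, Real.sin φ]

/-- A vertex guard of an `n`-gon: the vertex at which it is stationed, and the angular range over
which it broadcasts, an arbitrary interval of angles (it may contain any of its endpoints or
none). -/
structure VertexGuard (n : ℕ) where
  vertex : Fin n
  range : Set ℝ
  interval : range.OrdConnected

/-- The broadcast region of a guard: the cone with apex at its vertex that is spanned by the
directions in its angular range. The polygon does not block the broadcast. -/
def VertexGuard.region {n : ℕ} (g : VertexGuard n) (P : Polygon Plane n) : Set Plane :=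
  {x | ∃ r : ℝ, 0 ≤ r ∧ ∃ φ ∈ g.range, x = P g.vertex + r • direction φ}

/-- Monotone Boolean formulas (AND and OR only) in variables indexed by `ι`. -/
inductive MonotoneFormula (ι : Type) : Type where
  | var : ι → MonotoneFormula ι
  | and : MonotoneFormula ι → MonotoneFormula ι → MonotoneFormula ι
  | or : MonotoneFormula ι → MonotoneFormula ι → MonotoneFormula ι

/-- The truth value of a formula when variable `i` has truth value `v i`. -/
def MonotoneFormula.Eval {ι : Type} (v : ι → Prop) : MonotoneFormula ι → Prop
  | .var i => v i
  | .and F G => F.Eval v ∧ G.Eval v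
  | .or F G => F.Eval v ∨ G.Eval v

/-- The guards `g 0, …, g (k - 1)` localize `P` if some monotone formula in the received broadcasts
decides, for every point of the plane off the boundary of `P`, whether it is inside or outside. -/
def Localizes {n k : ℕ} (g : Fin k → VertexGuard n) (P : Polygon Plane n) : Prop :=
  ∃ F : MonotoneFormula (Fin k), ∀ x : Plane, x ∉ P.boundary ℝ →
    (F.Eval (fun i => x ∈ (g i).region P) ↔ x ∈ inside P)

/-- Every family of vertex guards that localizes `P` has at least `b` members (several guards may
be stationed at the same vertex). -/
def RequiresVertexGuards {n : ℕ} (P : Polygon Plane n) (b : ℕ) : Prop :=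
  ∀ (k : ℕ) (g : Fin k → VertexGuard n), Localizes g P → b ≤ k

end WirelessLocalization

namespace WirelessLocalization

open Set MeasureTheory

/-! The polygon lies between an x-monotone staircase and a lid near height 5. Apart from its two end
vertices, the staircase consists of groups of three vertices at heights near 0, 2, 1, one unit apart
inside a group, with enormous distances between groups. The claim is that every complete group needs
two guards stationed at its own vertices, and that an incomplete last group with at least two
vertices, the lid's end included, needs one; counting groups gives the bound.

Since the formula is monotone, some guard receives any given inside point but not any given outside
point (`Localizes.exists_separating`). Take many short horizontal test segments near a group, each
from inside to outside. A guard outside the group sees them in disjoint angular ranges, and the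
interval of a cone has only two ends, so it separates the ends of at most two segments
(`VertexGuard.card_separated_le`). With more levels than the far guards can handle, some level is
left to the guards of the group (`FarFrom.exists_level`). Hence each group has a guard.

A lone guard at a vertex `A` of a complete group fails because from each of the three vertices some
ray meets both an inside point `x` and an outside point `y`. Compared with an outside point at its
height, `x` must be received; compared with an inside point at its height, `y` must not be. A cone
with apex `A` cannot do both (`FarFrom.two_own`). All estimates have slack, so the polygon may be
perturbed, in particular into general position. -/

/-! ### Polygons bounded by an x-monotone chain and a lid -/

/-- The affine function through the points `(X i, Y i)` and `(X j, Y j)`. -/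
noncomputable def chord (X Y : ℕ → ℝ) (i j : ℕ) (x : ℝ) : ℝ :=
  Y i + (Y j - Y i) / (X j - X i) * (x - X i)

/-- The piecewise affine interpolation of the points `(X j, Y j)`, `j ≤ N`, constant beyond the
extreme ones. -/
noncomputable def polyline (X Y : ℕ → ℝ) (N : ℕ) (x : ℝ) : ℝ :=
  Y 0 + ∑ j ∈ Finset.range N,
    (Y (j + 1) - Y j) / (X (j + 1) - X j) * (max (X j) (min x (X (j + 1))) - X j)

/-- A polygon made of an `x`-monotone chain from vertex `0` to vertex `N` and of the edge between
these two vertices, which runs above the chain. -/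
structure IsLidded {N : ℕ} (Q : Polygon Plane (N + 1)) (X Y : ℕ → ℝ) : Prop where
  two_le : 2 ≤ N
  coord : ∀ i : Fin (N + 1), Q i = !₂[X i, Y i]
  step : ∀ i < N, X i < X (i + 1)
  below : ∀ i, 0 < i → i < N → Y i < chord X Y 0 N (X i)

lemma chord_left (X Y : ℕ → ℝ) (i j : ℕ) : chord X Y i j (X i) = Y i := by
  simp [chord]

lemma chord_right {X : ℕ → ℝ} (Y : ℕ → ℝ) {i j : ℕ} (h : X i < X j) :
    chord X Y i j (X j) = Y j := by
  have : X j - X i ≠ 0 := by linarith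
  simp only [chord]
  field_simp
  ring

lemma continuous_chord (X Y : ℕ → ℝ) (i j : ℕ) : Continuous (chord X Y i j) := by
  unfold chord; fun_prop

lemma continuous_polyline (X Y : ℕ → ℝ) (N : ℕ) : Continuous (polyline X Y N) := by
  unfold polyline; fun_prop

lemma mem_affineSegment_iff {a b c d : ℝ} (h : a < c) (p : Plane) :
    p ∈ affineSegment ℝ (!₂[a, b] : Plane) !₂[c, d] ↔
      a ≤ p 0 ∧ p 0 ≤ c ∧ p 1 = b + (d - b) / (c - a) * (p 0 - a) := by
  have hca : 0 < c - a := by linarith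
  constructor
  · rintro ⟨t, ⟨h0, h1⟩, rfl⟩
    simp only [AffineMap.lineMap_apply, vsub_eq_sub, vadd_eq_add, PiLp.add_apply, PiLp.smul_apply,
      PiLp.sub_apply, smul_eq_mul, Matrix.cons_val_zero, Matrix.cons_val_one]
    refine ⟨by nlinarith, by nlinarith, ?_⟩
    field_simp
    ring
  · rintro ⟨h0, h1, h2⟩
    refine ⟨(p 0 - a) / (c - a), ⟨by apply div_nonneg <;> linarith, ?_⟩, ?_⟩
    · rw [div_le_one hca]; linarith
    · ext i
      fin_cases i
      · simp [AffineMap.lineMap_apply]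
        field_simp
        ring
      · simp [AffineMap.lineMap_apply, h2]
        field_simp
        ring

variable {N : ℕ} {Q : Polygon Plane (N + 1)} {X Y : ℕ → ℝ}

lemma IsLidded.strict (h : IsLidded Q X Y) {i j : ℕ} (hij : i < j) (hj : j ≤ N) : X i < X j := by
  induction j, hij using Nat.le_induction with
  | base => exact h.step i hj
  | succ k hk ih => exact (ih (by omega)).trans (h.step k hj)

lemma IsLidded.mono (h : IsLidded Q X Y) {i j : ℕ} (hij : i ≤ j) (hj : j ≤ N) : X i ≤ X j := by
  rcases hij.eq_or_lt with rfl | hlt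
  · exact le_rfl
  · exact (h.strict hlt hj).le

lemma IsLidded.mem_edgeSet (h : IsLidded Q X Y) {i : Fin (N + 1)} (hi : (i : ℕ) < N) (p : Plane) :
    p ∈ Q.edgeSet ℝ i ↔ X i ≤ p 0 ∧ p 0 ≤ X (i + 1) ∧ p 1 = chord X Y i (i + 1) (p 0) := by
  have : finRotate (N + 1) i = ⟨i + 1, by omega⟩ := finRotate_of_lt hi
  rw [Polygon.edgeSet, this, h.coord, h.coord, mem_affineSegment_iff (h.step i hi)]
  rfl

lemma IsLidded.mem_edgeSet_last (h : IsLidded Q X Y) (p : Plane) :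
    p ∈ Q.edgeSet ℝ (Fin.last N) ↔ X 0 ≤ p 0 ∧ p 0 ≤ X N ∧ p 1 = chord X Y 0 N (p 0) := by
  have h2 := h.two_le
  rw [Polygon.edgeSet, finRotate_last, affineSegment_comm, h.coord, h.coord, Fin.val_last,
    Fin.val_zero, mem_affineSegment_iff (h.strict (by omega) le_rfl)]
  rfl

lemma IsLidded.le_lid (h : IsLidded Q X Y) {i : ℕ} (hi : i ≤ N) : Y i ≤ chord X Y 0 N (X i) := by
  have h2 := h.two_le
  rcases Nat.eq_zero_or_pos i with rfl | h0
  · rw [chord_left]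
  rcases hi.eq_or_lt with rfl | hN
  · rw [chord_right Y (h.strict h0 le_rfl)]
  · exact (h.below i h0 hN).le

/-- The vertical gap between the lid and an edge of the chain, as a convex combination of the gaps
at the ends of that edge. -/
lemma IsLidded.gap (h : IsLidded Q X Y) {i : ℕ} (hi : i < N) (x : ℝ) :
    (X (i + 1) - X i) * (chord X Y 0 N x - chord X Y i (i + 1) x) =
      (X (i + 1) - x) * (chord X Y 0 N (X i) - Y i) +
        (x - X i) * (chord X Y 0 N (X (i + 1)) - Y (i + 1)) := by
  have h1 := h.step i hi
  have h3 : X (i + 1) - X i ≠ 0 := by linarith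
  simp only [chord]
  generalize (Y N - Y 0) / (X N - X 0) = s
  field_simp
  ring

lemma IsLidded.chord_le_lid (h : IsLidded Q X Y) {i : ℕ} (hi : i < N) {x : ℝ} (h0 : X i ≤ x)
    (h1 : x ≤ X (i + 1)) : chord X Y i (i + 1) x ≤ chord X Y 0 N x := by
  have hg := h.gap hi x
  have h2 := h.step i hi
  have h3 := h.le_lid hi.le
  have h4 := h.le_lid hi
  by_contra! hc
  nlinarith [mul_nonneg (sub_nonneg.2 h0) (sub_nonneg.2 h4),
    mul_nonneg (sub_nonneg.2 h1) (sub_nonneg.2 h3)]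

/-- Both terms on the right of `IsLidded.gap` are nonnegative, so contact with the lid makes both
vanish. As `2 ≤ N`, each edge has an end with positive gap, and this pushes the contact to an
extreme abscissa. -/
lemma IsLidded.chord_lt_lid (h : IsLidded Q X Y) {i : ℕ} (hi : i < N) {x : ℝ} (h0 : X i ≤ x)
    (h1 : x ≤ X (i + 1)) (hl : X 0 < x) (hr : x < X N) :
    chord X Y i (i + 1) x < chord X Y 0 N x := by
  have hg := h.gap hi x
  have h2 := h.step i hi
  have h3 := h.le_lid hi.le
  have h4 := h.le_lid hi
  by_contra! hc
  have e1 := mul_nonneg (sub_nonneg.2 h0) (sub_nonneg.2 h4)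
  have e2 := mul_nonneg (sub_nonneg.2 h1) (sub_nonneg.2 h3)
  have e3 : (X (i + 1) - x) * (chord X Y 0 N (X i) - Y i) = 0 := by nlinarith
  have e4 : (x - X i) * (chord X Y 0 N (X (i + 1)) - Y (i + 1)) = 0 := by nlinarith
  rcases h0.eq_or_lt with h5 | h5
  · rcases Nat.eq_zero_or_pos i with rfl | h6
    · exact hl.ne h5
    · have := h.below i h6 hi
      have : 0 < (X (i + 1) - x) * (chord X Y 0 N (X i) - Y i) := mul_pos (by linarith) (by linarith)
      linarith
  · rcases (Nat.succ_le_of_lt hi).eq_or_lt with h6 | h6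
    · have h7 : i + 1 = N := h6
      rcases Nat.eq_zero_or_pos i with rfl | h8
      · have := h.two_le; omega
      · have := h.below i h8 hi
        have : 0 < (X (i + 1) - x) * (chord X Y 0 N (X i) - Y i) :=
          mul_pos (by rw [h7]; linarith) (by linarith)
        linarith
    · have := h.below (i + 1) (by omega) h6
      have : 0 < (x - X i) * (chord X Y 0 N (X (i + 1)) - Y (i + 1)) :=
        mul_pos (by linarith) (by linarith)
      linarith

lemma IsLidded.polyline_eq (h : IsLidded Q X Y) {i : ℕ} (hi : i < N) {x : ℝ} (h0 : X i ≤ x)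
    (h1 : x ≤ X (i + 1)) : polyline X Y N x = chord X Y i (i + 1) x := by
  -- The clamped summands before `i` are full increments and telescope; those after `i` vanish.
  have key : ∀ j < N, (Y (j + 1) - Y j) / (X (j + 1) - X j) *
      (max (X j) (min x (X (j + 1))) - X j) =
      if j < i then Y (j + 1) - Y j else if j = i then
        (Y (i + 1) - Y i) / (X (i + 1) - X i) * (x - X i) else 0 := by
    intro j hj
    have hs := h.step j hj
    split_ifs with c1 c2
    · have : X (j + 1) ≤ X i := h.mono c1 hi.le
      rw [min_eq_right (by linarith), max_eq_right hs.le, div_mul_cancel₀]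
      linarith
    · subst c2
      rw [min_eq_left h1, max_eq_right h0]
    · have : X (i + 1) ≤ X j := h.mono (by omega) hj.le
      rw [min_eq_left (by linarith), max_eq_left (by linarith)]
      simp
  have split : Finset.range N = Finset.range i ∪ Finset.Ico i N := by
    ext j; simp; omega
  unfold polyline
  rw [Finset.sum_congr rfl fun j hj => key j (Finset.mem_range.1 hj), split,
    Finset.sum_union (by rw [Finset.disjoint_left]; intro j; simp; omega),
    Finset.sum_congr (g := fun j => Y (j + 1) - Y j) rfl
      fun j hj => by simp [Finset.mem_range.1 hj], Finset.sum_range_sub,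
    Finset.sum_eq_single i]
  · simp [chord]
    ring
  · intro j hj hne
    have := (Finset.mem_Ico.1 hj).1
    simp [hne, Nat.not_lt.2 this]
  · intro hn; simp [hi] at hn

lemma IsLidded.exists_edge (h : IsLidded Q X Y) {x : ℝ} (h0 : X 0 ≤ x) (h1 : x ≤ X N) :
    ∃ i < N, X i ≤ x ∧ x ≤ X (i + 1) := by
  have h2 := h.two_le
  by_contra! hc
  have : ∀ j ≤ N, j ≠ 0 → X j < x ∨ x ≤ X 0 := by
    intro j hj hj0
    induction j with
    | zero => simp at hj0
    | succ k ih =>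
      rcases Nat.eq_zero_or_pos k with rfl | hk
      · exact Or.inl (hc 0 (by omega) h0)
      · rcases ih (by omega) (by omega) with h3 | h3
        · exact Or.inl (hc k (by omega) h3.le)
        · exact Or.inr h3
  have h4 := hc 0 (by omega) h0
  have h5 := h.step 0 (by omega)
  rcases this N le_rfl (by omega) with h3 | h3 <;> simp at * <;> linarith

lemma IsLidded.mem_boundary (h : IsLidded Q X Y) (p : Plane) :
    p ∈ Q.boundary ℝ ↔
      X 0 ≤ p 0 ∧ p 0 ≤ X N ∧ (p 1 = polyline X Y N (p 0) ∨ p 1 = chord X Y 0 N (p 0)) := by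
  rw [Polygon.boundary, mem_iUnion]
  constructor
  · rintro ⟨i, hi⟩
    rcases Nat.lt_or_ge i N with hN | hN
    · rw [h.mem_edgeSet hN] at hi
      obtain ⟨a, b, c⟩ := hi
      refine ⟨(h.mono (Nat.zero_le _) hN.le).trans a, b.trans (h.mono hN le_rfl), Or.inl ?_⟩
      rw [h.polyline_eq hN a b, c]
    · obtain rfl : i = Fin.last N := Fin.ext (by rw [Fin.val_last]; omega)
      rw [h.mem_edgeSet_last] at hi
      exact ⟨hi.1, hi.2.1, Or.inr hi.2.2⟩
  · rintro ⟨h0, h1, h2 | h2⟩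
    · obtain ⟨i, hi, a, b⟩ := h.exists_edge h0 h1
      refine ⟨⟨i, by omega⟩, (h.mem_edgeSet hi p).2 ⟨a, b, ?_⟩⟩
      rw [h2, h.polyline_eq hi a b]
    · exact ⟨Fin.last N, (h.mem_edgeSet_last p).2 ⟨h0, h1, h2⟩⟩

lemma IsLidded.polyline_le_lid (h : IsLidded Q X Y) {x : ℝ} (h0 : X 0 ≤ x) (h1 : x ≤ X N) :
    polyline X Y N x ≤ chord X Y 0 N x := by
  obtain ⟨i, hi, a, b⟩ := h.exists_edge h0 h1
  rw [h.polyline_eq hi a b]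
  exact h.chord_le_lid hi a b

lemma IsLidded.adjacent_last (h : IsLidded Q X Y) {i : ℕ} (hi : i < N) {x : ℝ} (h0 : X i ≤ x)
    (h1 : x ≤ X (i + 1)) (he : chord X Y i (i + 1) x = chord X Y 0 N x) :
    (i = 0 ∧ x = X 0) ∨ (i + 1 = N ∧ x = X N) := by
  have h2 := h.two_le
  have a : X 0 ≤ x := (h.mono (Nat.zero_le _) hi.le).trans h0
  have b : x ≤ X N := h1.trans (h.mono hi le_rfl)
  rcases a.eq_or_lt with a | a
  · refine Or.inl ⟨?_, a.symm⟩
    by_contra hne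
    have := h.strict (Nat.pos_of_ne_zero hne) hi.le
    linarith
  · rcases b.eq_or_lt with b | b
    · refine Or.inr ⟨?_, b⟩
      by_contra hne
      have := h.strict (show i + 1 < N by omega) le_rfl
      linarith
    · exact absurd he (h.chord_lt_lid hi h0 h1 a b).ne

lemma plane_ext {p q : Plane} (h0 : p 0 = q 0) (h1 : p 1 = q 1) : p = q := by
  ext i; fin_cases i <;> assumption

lemma IsLidded.coord_zero (h : IsLidded Q X Y) (i : Fin (N + 1)) : Q i 0 = X i := by
  rw [h.coord]; rfl

lemma IsLidded.coord_one (h : IsLidded Q X Y) (i : Fin (N + 1)) : Q i 1 = Y i := by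
  rw [h.coord]; rfl

lemma IsLidded.isSimple (h : IsLidded Q X Y) : IsSimple Q := by
  have h2 := h.two_le
  have left_end (i : Fin (N + 1)) : Q i ∈ Q.edgeSet ℝ i := left_mem_affineSegment ℝ _ _
  have right_end (i : Fin (N + 1)) : Q (finRotate (N + 1) i) ∈ Q.edgeSet ℝ i :=
    right_mem_affineSegment ℝ _ _
  have rot (i : Fin (N + 1)) (hi : (i : ℕ) < N) : ((finRotate (N + 1) i : Fin (N + 1)) : ℕ) = i + 1 := by
    rw [show finRotate (N + 1) i = ⟨i + 1, by omega⟩ from finRotate_of_lt hi]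
  refine ⟨by omega, ?_, ?_, ?_⟩
  · intro i j hij
    have e : X i = X j := by
      rw [← h.coord_zero, ← h.coord_zero, hij]
    by_contra hne
    rcases lt_or_gt_of_ne (fun c => hne (Fin.ext c)) with c | c
    · exact (h.strict c (by omega)).ne e
    · exact (h.strict c (by omega)).ne' e
  · intro i
    apply Subset.antisymm
    · rintro p ⟨hp, hq⟩
      rw [mem_singleton_iff]
      rcases Nat.lt_or_ge i N with hN | hN
      · have hr := rot i hN
        rw [h.mem_edgeSet hN] at hp
        rcases Nat.lt_or_ge (i + 1) N with hN' | hN'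
        · rw [h.mem_edgeSet (by omega), hr] at hq
          have e : p 0 = X (i + 1) := le_antisymm hp.2.1 hq.1
          apply plane_ext
          · rw [h.coord_zero, hr, e]
          · rw [h.coord_one, hr, hp.2.2, e, chord_right Y (h.step i hN)]
        · have hl : finRotate (N + 1) i = Fin.last N := Fin.ext (by rw [hr]; simp; omega)
          rw [hl, h.mem_edgeSet_last] at hq
          have := h.adjacent_last hN hp.1 hp.2.1 (hp.2.2.symm.trans hq.2.2)
          have e : p 0 = X N := by
            rcases this with ⟨c, -⟩ | ⟨-, c⟩
            · omega
            · exact c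
          rw [hl]
          apply plane_ext
          · rw [h.coord_zero, e]; rfl
          · rw [h.coord_one, hq.2.2, e, chord_right Y (h.strict (by omega) le_rfl)]; rfl
      · obtain rfl : i = Fin.last N := Fin.ext (by rw [Fin.val_last]; omega)
        rw [finRotate_last] at hq ⊢
        rw [h.mem_edgeSet_last] at hp
        rw [h.mem_edgeSet (by simp; omega)] at hq
        have := h.adjacent_last (i := 0) (by omega) hq.1 hq.2.1 (hq.2.2.symm.trans hp.2.2)
        have e : p 0 = X 0 := by
          rcases this with ⟨-, c⟩ | ⟨c, -⟩
          · exact c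
          · omega
        apply plane_ext
        · rw [h.coord_zero, e]; rfl
        · rw [h.coord_one, hp.2.2, e, chord_left]; rfl
    · rintro _ rfl
      exact ⟨right_end i, left_end _⟩
  · have chain (i j : Fin (N + 1)) (hj : (j : ℕ) < N) (hij : (i : ℕ) + 1 < j) :
        Disjoint (Q.edgeSet ℝ i) (Q.edgeSet ℝ j) := by
      rw [disjoint_left]
      intro p hp hq
      rw [h.mem_edgeSet (by omega)] at hp
      rw [h.mem_edgeSet hj] at hq
      have := h.strict hij hj.le
      linarith [hp.2.1, hq.1]
    have lid (i : Fin (N + 1)) (hi : (i : ℕ) < N) (h0 : (i : ℕ) ≠ 0) (h1 : (i : ℕ) + 1 ≠ N) :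
        Disjoint (Q.edgeSet ℝ i) (Q.edgeSet ℝ (Fin.last N)) := by
      rw [disjoint_left]
      intro p hp hq
      rw [h.mem_edgeSet hi] at hp
      rw [h.mem_edgeSet_last] at hq
      have := h.adjacent_last hi hp.1 hp.2.1 (hp.2.2.symm.trans hq.2.2)
      omega
    have lid' (i : Fin (N + 1)) (hi : (i : ℕ) < N) (h0 : finRotate (N + 1) (Fin.last N) ≠ i)
        (h1 : finRotate (N + 1) i ≠ Fin.last N) :
        Disjoint (Q.edgeSet ℝ i) (Q.edgeSet ℝ (Fin.last N)) := by
      apply lid i hi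
      · intro c
        exact h0 (by rw [finRotate_last]; exact Fin.ext (by simp [c]))
      · intro c
        exact h1 (Fin.ext (by rw [rot i hi, c]; rfl))
    intro i j hij h1 h3
    have hij' : (i : ℕ) ≠ j := fun c => hij (Fin.ext c)
    rcases Nat.lt_or_ge i N with hi | hi
    · rcases Nat.lt_or_ge j N with hj | hj
      · have h1' : (i : ℕ) + 1 ≠ j := fun c => h1 (Fin.ext (by rw [rot i hi, c]))
        have h3' : (j : ℕ) + 1 ≠ i := fun c => h3 (Fin.ext (by rw [rot j hj, c]))
        rcases lt_or_gt_of_ne hij' with c | c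
        · exact chain i j hj (by omega)
        · exact (chain j i hi (by omega)).symm
      · obtain rfl : j = Fin.last N := Fin.ext (by simp; omega)
        exact lid' i hi h3 h1
    · obtain rfl : i = Fin.last N := Fin.ext (by rw [Fin.val_last]; omega)
      exact (lid' j (by simp at hij'; omega) h1 h3).symm

/-- The closed region `A` between chain and lid and the closed set `B` of points not strictly
between them cover the plane and meet only on the boundary. A connected set off the boundary that
starts in `A` therefore stays in the bounded set `A`. -/
lemma IsLidded.mem_inside (h : IsLidded Q X Y) {p : Plane} (h0 : X 0 < p 0) (h1 : p 0 < X N)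
    (h2 : polyline X Y N (p 0) < p 1) (h3 : p 1 < chord X Y 0 N (p 0)) : p ∈ inside Q := by
  have hp : p ∉ Q.boundary ℝ := by
    rw [h.mem_boundary]
    rintro ⟨-, -, c | c⟩ <;> linarith
  refine ⟨hp, ?_⟩
  set A : Set Plane := {q | X 0 ≤ q 0 ∧ q 0 ≤ X N ∧ polyline X Y N (q 0) ≤ q 1 ∧
    q 1 ≤ chord X Y 0 N (q 0)}
  set B : Set Plane := {q | q 0 ≤ X 0 ∨ X N ≤ q 0 ∨ q 1 ≤ polyline X Y N (q 0) ∨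
    chord X Y 0 N (q 0) ≤ q 1}
  have c0 : Continuous fun q : Plane => q 0 := by fun_prop
  have c1 : Continuous fun q : Plane => q 1 := by fun_prop
  have cl : Continuous fun q : Plane => polyline X Y N (q 0) := (continuous_polyline X Y N).comp c0
  have cu : Continuous fun q : Plane => chord X Y 0 N (q 0) := (continuous_chord X Y 0 N).comp c0
  have hA : IsClosed A :=
    (isClosed_le continuous_const c0).inter ((isClosed_le c0 continuous_const).inter
      ((isClosed_le cl c1).inter (isClosed_le c1 cu)))
  have hB : IsClosed B :=
    (isClosed_le c0 continuous_const).union ((isClosed_le continuous_const c0).union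
      ((isClosed_le c1 cl).union (isClosed_le cu c1)))
  set C := connectedComponentIn (Q.boundary ℝ)ᶜ p
  have hpC : p ∈ C := mem_connectedComponentIn hp
  have hAB : C ⊆ A ∪ B := by
    intro q _
    by_cases hq : q ∈ B
    · exact Or.inr hq
    · simp only [B, mem_ofPred_eq, not_or, not_le] at hq
      exact Or.inl ⟨hq.1.le, hq.2.1.le, hq.2.2.1.le, hq.2.2.2.le⟩
  have hx := h.strict (show 0 < N by have := h.two_le; omega) le_rfl
  -- Chain and lid agree at both extreme abscissas, so the vertical sides of `A` shrink to boundary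
  -- points.
  have l0 : polyline X Y N (X 0) = Y 0 := by
    have := h.two_le
    rw [h.polyline_eq (i := 0) (by omega) le_rfl (h.mono (by omega) (by omega)), chord_left]
  have l1 : polyline X Y N (X N) = Y N := by
    have h2 := h.two_le
    have e : N - 1 + 1 = N := by omega
    have := h.step (N - 1) (by omega)
    rw [h.polyline_eq (i := N - 1) (by omega) (h.mono (by omega) le_rfl) (by rw [e]), e,
      chord_right Y (by rw [← e] at this ⊢; simpa using this)]
  have hdisj : ¬ (C ∩ (A ∩ B)).Nonempty := by
    rintro ⟨q, hqC, hqA, hqB⟩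
    have hq : q ∉ Q.boundary ℝ := connectedComponentIn_subset _ _ hqC
    rw [h.mem_boundary] at hq
    obtain ⟨a1, a2, a3, a4⟩ := hqA
    rcases hqB with b | b | b | b
    · have e : q 0 = X 0 := le_antisymm b a1
      rw [e, l0] at a3
      rw [e, chord_left] at a4
      exact hq ⟨a1, a2, Or.inl (by rw [e, l0]; linarith)⟩
    · have e : q 0 = X N := le_antisymm a2 b
      rw [e, l1] at a3
      rw [e, chord_right Y hx] at a4
      exact hq ⟨a1, a2, Or.inl (by rw [e, l1]; linarith)⟩
    · exact hq ⟨a1, a2, Or.inl (le_antisymm b a3)⟩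
    · exact hq ⟨a1, a2, Or.inr (le_antisymm a4 b)⟩
  have hCA : C ⊆ A := by
    intro q hq
    by_contra hqA
    have hqB : q ∈ B := (hAB hq).resolve_left hqA
    exact hdisj (isPreconnected_closed_iff.1 isPreconnected_connectedComponentIn A B hA hB hAB
      ⟨p, hpC, h0.le, h1.le, h2.le, h3.le⟩ ⟨q, hq, hqB⟩)
  obtain ⟨lo, hlo⟩ := (isCompact_Icc (a := X 0) (b := X N)).bddBelow_image
    (continuous_polyline X Y N).continuousOn
  obtain ⟨hi, hhi⟩ := (isCompact_Icc (a := X 0) (b := X N)).bddAbove_image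
    (continuous_chord X Y 0 N).continuousOn
  refine Bornology.IsBounded.subset (t := {q : Plane | q 0 ∈ Icc (X 0) (X N) ∧ q 1 ∈ Icc lo hi}) ?_ ?_
  · rw [isBounded_iff_forall_norm_le]
    refine ⟨(|X 0| + |X N|) + (|lo| + |hi|), ?_⟩
    rintro q ⟨⟨q1, q2⟩, q3, q4⟩
    rw [EuclideanSpace.norm_eq, Real.sqrt_le_left (by positivity), Fin.sum_univ_two,
      Real.norm_eq_abs, Real.norm_eq_abs]
    have e1 : |q 0| ≤ |X 0| + |X N| := by
      rw [abs_le]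
      constructor <;> linarith [neg_abs_le (X 0), le_abs_self (X N), abs_nonneg (X 0), abs_nonneg (X N)]
    have e2 : |q 1| ≤ |lo| + |hi| := by
      rw [abs_le]
      constructor <;> linarith [neg_abs_le lo, le_abs_self hi, abs_nonneg lo, abs_nonneg hi]
    nlinarith [abs_nonneg (q 0), abs_nonneg (q 1)]
  · intro q hq
    obtain ⟨a1, a2, a3, a4⟩ := hCA hq
    exact ⟨⟨a1, a2⟩, (hlo ⟨q 0, ⟨a1, a2⟩, rfl⟩).trans a3, a4.trans (hhi ⟨q 0, ⟨a1, a2⟩, rfl⟩)⟩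

/-- The vertical ray downwards from the point misses the boundary, so its component is unbounded. -/
lemma IsLidded.not_mem_of_lt (h : IsLidded Q X Y) {p : Plane} (h0 : X 0 ≤ p 0) (h1 : p 0 ≤ X N)
    (h2 : p 1 < polyline X Y N (p 0)) : p ∉ Q.boundary ℝ ∧ p ∉ inside Q := by
  have hray : ∀ s ≤ p 1, (!₂[p 0, s] : Plane) ∈ (Q.boundary ℝ)ᶜ := by
    intro s hs
    rw [mem_compl_iff, h.mem_boundary]
    simp only [Matrix.cons_val_zero, Matrix.cons_val_one]
    have := h.polyline_le_lid h0 h1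
    rintro ⟨-, -, c | c⟩ <;> linarith
  have hp : (!₂[p 0, p 1] : Plane) = p := plane_ext rfl rfl
  have hpb := hray _ le_rfl
  rw [hp] at hpb
  refine ⟨hpb, fun hin => ?_⟩
  have hsub : (fun s : ℝ => (!₂[p 0, s] : Plane)) '' Iic (p 1) ⊆
      connectedComponentIn (Q.boundary ℝ)ᶜ p := by
    apply IsPreconnected.subset_connectedComponentIn
    · refine isPreconnected_Iic.image _ (Continuous.continuousOn ?_)
      apply (PiLp.continuous_toLp 2 _).comp
      refine continuous_pi fun i => ?_
      fin_cases i
      · exact continuous_const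
      · exact continuous_id
    · exact ⟨p 1, self_mem_Iic, hp⟩
    · rintro _ ⟨s, hs, rfl⟩
      exact hray s hs
  obtain ⟨R, hR⟩ := isBounded_iff_forall_norm_le.1 (hin.2.subset hsub)
  have := hR _ ⟨min (p 1) (-(|R| + 1)), mem_Iic.2 (min_le_left _ _), rfl⟩
  have h3 := (PiLp.norm_apply_le (!₂[p 0, min (p 1) (-(|R| + 1))] : Plane) 1).trans this
  simp only [Matrix.cons_val_one, Matrix.cons_val_fin_one, Real.norm_eq_abs] at h3
  have h4 := neg_abs_le (min (p 1) (-(|R| + 1)))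
  have h5 := min_le_right (p 1) (-(|R| + 1))
  linarith [le_abs_self R]

/-! ### Separation of points by cones -/

lemma MonotoneFormula.eval_mono {ι : Type} {v w : ι → Prop} (h : ∀ i, v i → w i)
    (F : MonotoneFormula ι) : F.Eval v → F.Eval w := by
  induction F with
  | var i => exact h i
  | and F G hF hG => exact fun c => ⟨hF c.1, hG c.2⟩
  | or F G hF hG => exact fun c => c.imp hF hG

/-- A localizing family tells apart any point inside from any point outside. -/
lemma Localizes.exists_separating {n k : ℕ} {g : Fin k → VertexGuard n} {P : Polygon Plane n}
    (h : Localizes g P) {x y : Plane} (hx : x ∈ inside P) (hy : y ∉ P.boundary ℝ)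
    (hy' : y ∉ inside P) : ∃ i, x ∈ (g i).region P ∧ y ∉ (g i).region P := by
  obtain ⟨F, hF⟩ := h
  by_contra! hc
  exact hy' ((hF y hy).1 (F.eval_mono hc ((hF x hx.1).2 hx)))

lemma direction_zero (φ : ℝ) : direction φ 0 = Real.cos φ := rfl

lemma direction_one (φ : ℝ) : direction φ 1 = Real.sin φ := rfl

lemma VertexGuard.mem_region_of_ray {n : ℕ} (g : VertexGuard n) (P : Polygon Plane n)
    {w : Plane} {s t : ℝ} (hs : 0 < s) (ht : 0 < t)
    (h : P g.vertex + s • w ∈ g.region P) : P g.vertex + t • w ∈ g.region P := by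
  obtain ⟨r, hr, φ, hφ, e⟩ := h
  refine ⟨t / s * r, by positivity, φ, hφ, ?_⟩
  have e' : s • w = r • direction φ := add_left_cancel e
  rw [mul_smul, ← e', smul_smul, div_mul_cancel₀ _ hs.ne']

/-- The slope of the line from `z` to `p`. -/
noncomputable def slopeFrom (z p : Plane) : ℝ := (p 1 - z 1) / (p 0 - z 0)

/-- Points of the open half-plane on one side of the vertical line through the apex of a guard are
in its region if and only if the angle given by their slope is in its range, up to a constant and
to multiples of `2π`. -/
lemma VertexGuard.mem_region_iff {n : ℕ} (g : VertexGuard n) (P : Polygon Plane n) {p : Plane}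
    {κ : ℝ} (hκ : 0 < (p 0 - P g.vertex 0) * Real.cos κ) (hκ' : Real.sin κ = 0) :
    p ∈ g.region P ↔
      ∃ k : ℤ, Real.arctan (slopeFrom (P g.vertex) p) + κ + k * (2 * Real.pi) ∈ g.range := by
  -- The hypotheses force `cos κ = ±1`, the sign telling the side of the apex. Then `θ + κ` is a
  -- polar angle of `p - z`, and `R` is the distance.
  set z := P g.vertex with hz
  set θ := Real.arctan (slopeFrom z p) with hθ
  have hne : p 0 - z 0 ≠ 0 := fun c => by simp [c] at hκ
  have hcos : 0 < Real.cos θ := Real.cos_arctan_pos _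
  have htan : Real.sin θ = slopeFrom z p * Real.cos θ := by
    rw [← Real.tan_arctan (slopeFrom z p), ← hθ, Real.tan_mul_cos hcos.ne']
  have hck : Real.cos κ * Real.cos κ = 1 := by
    have := Real.sin_sq_add_cos_sq κ
    rw [hκ'] at this; linarith
  set R := (p 0 - z 0) * Real.cos κ / Real.cos θ with hR
  have hRpos : 0 < R := div_pos hκ hcos
  have hdir : p = z + R • direction (θ + κ) := by
    apply plane_ext
    · rw [PiLp.add_apply, PiLp.smul_apply, direction_zero, Real.cos_add, hκ', hR, smul_eq_mul]
      field_simp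
      linear_combination (-(p 0 - z 0) * Real.cos θ) * hck
    · rw [PiLp.add_apply, PiLp.smul_apply, direction_one, Real.sin_add, hκ', hR, smul_eq_mul, htan,
        slopeFrom]
      field_simp
      linear_combination (-(p 1 - z 1)) * hck
  constructor
  · rintro ⟨r, hr, φ, hφ, e⟩
    have e' : R • direction (θ + κ) = r • direction φ := add_left_cancel (hdir.symm.trans e)
    have e0 : R * Real.cos (θ + κ) = r * Real.cos φ := congrArg (fun v : Plane => v 0) e'
    have e1 : R * Real.sin (θ + κ) = r * Real.sin φ := congrArg (fun v : Plane => v 1) e'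
    have hRr : R = r := by
      have h1 := Real.sin_sq_add_cos_sq (θ + κ)
      have h2 := Real.sin_sq_add_cos_sq φ
      have h3 : R ^ 2 = r ^ 2 := by
        calc R ^ 2 = (R * Real.sin (θ + κ)) ^ 2 + (R * Real.cos (θ + κ)) ^ 2 := by
              linear_combination (-R ^ 2) * h1
          _ = r ^ 2 := by rw [e0, e1]; linear_combination r ^ 2 * h2
      exact (sq_eq_sq₀ hRpos.le hr).1 h3
    rw [← hRr] at e0 e1
    have := Real.Angle.cos_sin_inj (mul_left_cancel₀ hRpos.ne' e0) (mul_left_cancel₀ hRpos.ne' e1)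
    obtain ⟨k, hk⟩ := Real.Angle.angle_eq_iff_two_pi_dvd_sub.1 this.symm
    exact ⟨k, by convert hφ using 1; linarith⟩
  · rintro ⟨k, hk⟩
    refine ⟨R, hRpos.le, _, hk, ?_⟩
    rw [hdir]
    congr 2
    apply plane_ext
    · rw [direction_zero, direction_zero, Real.cos_add_int_mul_two_pi]
    · rw [direction_one, direction_one, Real.sin_add_int_mul_two_pi]

/-- The image of an interval on a circle does not contain the first and the third but neither the
second nor the fourth of four points in cyclic order. -/
lemma not_alternating {S : Set ℝ} (hS : S.OrdConnected) {T a b c d : ℝ}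
    (hab : a < b) (hbc : b < c) (hcd : c < d) (hda : d < a + T)
    (ha : ∃ k : ℤ, a + k * T ∈ S) (hb : ¬ ∃ k : ℤ, b + k * T ∈ S)
    (hc : ∃ k : ℤ, c + k * T ∈ S) (hd : ¬ ∃ k : ℤ, d + k * T ∈ S) : False := by
  obtain ⟨k, hk⟩ := ha
  obtain ⟨l, hl⟩ := hc
  have hT : 0 < T := by linarith
  -- Between the two lifts in `S` lies a lift of `b` if `k ≤ l`, and a lift of `d` otherwise.
  rcases le_or_gt k l with h | h
  · refine hb ⟨k, hS.out hk hl ⟨by linarith, ?_⟩⟩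
    have : (k : ℝ) * T ≤ l * T := by gcongr
    linarith
  · refine hd ⟨l, hS.out hl hk ⟨by linarith, ?_⟩⟩
    have : ((l : ℝ) + 1) * T ≤ k * T := by
      gcongr
      exact_mod_cast h
    linarith

/-- On one side of the vertical through the apex the angle increases with the slope, so increasing
slopes give points in cyclic order on a circle of length `2π`. -/
lemma VertexGuard.not_alternating {n : ℕ} (g : VertexGuard n) (P : Polygon Plane n) {κ : ℝ}
    (hκ' : Real.sin κ = 0) {a b c d : Plane}
    (ha : 0 < (a 0 - P g.vertex 0) * Real.cos κ) (hb : 0 < (b 0 - P g.vertex 0) * Real.cos κ)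
    (hc : 0 < (c 0 - P g.vertex 0) * Real.cos κ) (hd : 0 < (d 0 - P g.vertex 0) * Real.cos κ)
    (hab : slopeFrom (P g.vertex) a < slopeFrom (P g.vertex) b)
    (hbc : slopeFrom (P g.vertex) b < slopeFrom (P g.vertex) c)
    (hcd : slopeFrom (P g.vertex) c < slopeFrom (P g.vertex) d) :
    ¬ (a ∈ g.region P ∧ b ∉ g.region P ∧ c ∈ g.region P ∧ d ∉ g.region P) ∧
    ¬ (a ∉ g.region P ∧ b ∈ g.region P ∧ c ∉ g.region P ∧ d ∈ g.region P) := by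
  rw [g.mem_region_iff P ha hκ', g.mem_region_iff P hb hκ', g.mem_region_iff P hc hκ',
    g.mem_region_iff P hd hκ']
  have h1 := Real.neg_pi_div_two_lt_arctan (slopeFrom (P g.vertex) a)
  have h2 := Real.arctan_lt_pi_div_two (slopeFrom (P g.vertex) d)
  have h3 := Real.arctan_strictMono hab
  have h4 := Real.arctan_strictMono hbc
  have h5 := Real.arctan_strictMono hcd
  have hpi := Real.pi_pos
  constructor
  · rintro ⟨ma, mb, mc, md⟩
    exact WirelessLocalization.not_alternating g.interval (by linarith) (by linarith)
      (by linarith) (by linarith) ma mb mc md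
  · rintro ⟨ma, mb, mc, md⟩
    -- The second pattern is the first one started at `b`, with `a` moved by a full turn to the last
    -- place.
    refine WirelessLocalization.not_alternating (T := 2 * Real.pi)
      (d := Real.arctan (slopeFrom (P g.vertex) a) + κ + 2 * Real.pi) g.interval
      (by linarith) (by linarith) (by linarith) (by linarith) mb mc md ?_
    rintro ⟨k, hk⟩
    refine ma ⟨k + 1, ?_⟩
    convert hk using 1
    push_cast; ring

/-- Three pairs of points, seen from the apex of a guard in three successive disjoint angular
ranges, are not all separated by it. -/
lemma VertexGuard.not_separates_three {n : ℕ} (g : VertexGuard n) (P : Polygon Plane n) {κ : ℝ}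
    (hκ' : Real.sin κ = 0) {p q : Fin 3 → Plane}
    (hp : ∀ i, 0 < (p i 0 - P g.vertex 0) * Real.cos κ)
    (hq : ∀ i, 0 < (q i 0 - P g.vertex 0) * Real.cos κ)
    (hpq : ∀ i j, i < j → slopeFrom (P g.vertex) (p i) < slopeFrom (P g.vertex) (q j))
    (hqp : ∀ i j, i < j → slopeFrom (P g.vertex) (q i) < slopeFrom (P g.vertex) (p j)) :
    ¬ ∀ i, p i ∈ g.region P ∧ q i ∉ g.region P := by
  intro h
  have hne (i : Fin 3) : slopeFrom (P g.vertex) (p i) ≠ slopeFrom (P g.vertex) (q i) := by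
    intro c
    have := h i
    rw [g.mem_region_iff P (hp i) hκ', g.mem_region_iff P (hq i) hκ', c] at this
    exact this.2 this.1
  -- The order inside an outer pair decides which four of the six points alternate; the order inside
  -- the middle pair never matters.
  rcases lt_or_gt_of_ne (hne 2) with c | c
  · exact (g.not_alternating P hκ' (hp 0) (hq 1) (hp 2) (hq 2) (hpq 0 1 (by decide))
      (hqp 1 2 (by decide)) c).1 ⟨(h 0).1, (h 1).2, (h 2).1, (h 2).2⟩
  rcases lt_or_gt_of_ne (hne 0) with d | d
  · exact (g.not_alternating P hκ' (hp 0) (hq 0) (hp 1) (hq 2) d (hqp 0 1 (by decide))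
      (hpq 1 2 (by decide))).1 ⟨(h 0).1, (h 0).2, (h 1).1, (h 2).2⟩
  · exact (g.not_alternating P hκ' (hq 0) (hp 0) (hq 1) (hp 2) d (hpq 0 1 (by decide))
      (hqp 1 2 (by decide))).2 ⟨(h 0).2, (h 0).1, (h 1).2, (h 2).1⟩

/-! ### Guards far from a family of test segments -/

lemma exists_lt_lt_of_two_lt_card {s : Finset ℕ} (h : 2 < s.card) :
    ∃ a ∈ s, ∃ b ∈ s, ∃ c ∈ s, a < b ∧ b < c := by
  have e := s.orderEmbOfFin_mem rfl
  refine ⟨_, e ⟨0, by omega⟩, _, e ⟨1, by omega⟩, _, e ⟨2, h⟩, ?_, ?_⟩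
  · exact (s.orderEmbOfFin rfl).strictMono (Fin.mk_lt_mk.2 (by omega))
  · exact (s.orderEmbOfFin rfl).strictMono (Fin.mk_lt_mk.2 (by omega))

open scoped Classical in
/-- A guard whose apex is horizontally far from a family of horizontal segments at well separated
heights separates the ends of at most two of them. -/
lemma VertexGuard.card_separated_le {n : ℕ} (g : VertexGuard n) (P : Polygon Plane n)
    {a b D δ : ℝ} {t : ℕ → ℝ} {J : ℕ} (hδ : 0 < δ) (ht : ∀ i j, i < j → t i + δ ≤ t j)
    (hD : 0 < D) (hDδ : 96 < D * δ) (hab : |a - b| ≤ 12)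
    (hy : ∀ j < J, |t j - P g.vertex 1| ≤ 8)
    (hx : (P g.vertex 0 ≤ a - D ∧ P g.vertex 0 ≤ b - D) ∨
      (a + D ≤ P g.vertex 0 ∧ b + D ≤ P g.vertex 0)) :
    ((Finset.range J).filter fun j => (!₂[a, t j] : Plane) ∈ g.region P ∧
      (!₂[b, t j] : Plane) ∉ g.region P).card ≤ 2 := by
  by_contra! hc
  obtain ⟨j0, m0, j1, m1, j2, m2, h01, h12⟩ := exists_lt_lt_of_two_lt_card hc
  simp only [Finset.mem_filter, Finset.mem_range] at m0 m1 m2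
  set z := P g.vertex
  -- After cross-multiplication, the differing distances to the apex cost at most `8 * 12 = 96`,
  -- while the difference in height gains at least `D * δ`.
  have key : ∀ i < J, ∀ j < J, i < j → ∀ u v : ℝ, D ≤ u → D ≤ v → |u - v| ≤ 12 →
      (t i - z 1) / u < (t j - z 1) / v := by
    intro i hi j hj hij u v hu hv huv
    rw [div_lt_div_iff₀ (by linarith) (by linarith)]
    have h1 := ht i j hij
    have h2 := hy i hi
    have h3 : (t i - z 1) * (v - u) ≤ 8 * 12 := by
      refine (le_abs_self _).trans ?_
      rw [abs_mul, abs_sub_comm v u]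
      gcongr
    have h4 : D * δ ≤ u * (t j - t i) := by
      apply mul_le_mul hu (by linarith) hδ.le (by linarith)
    nlinarith
  have hba : |b - a| ≤ 12 := by rwa [abs_sub_comm]
  rcases hx with ⟨ha, hb⟩ | ⟨ha, hb⟩
  · refine g.not_separates_three P (κ := 0) Real.sin_zero
      (p := ![!₂[a, t j0], !₂[a, t j1], !₂[a, t j2]])
      (q := ![!₂[b, t j0], !₂[b, t j1], !₂[b, t j2]]) ?_ ?_ ?_ ?_ ?_
    · intro i; fin_cases i <;> simp <;> linarith
    · intro i; fin_cases i <;> simp <;> linarith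
    · intro i j hij
      have k := fun i hi j hj hij => key i hi j hj hij (a - z 0) (b - z 0) (by linarith)
        (by linarith) (by simpa using hab)
      fin_cases i <;> fin_cases j <;> simp at hij <;> simp [slopeFrom]
      · exact k _ m0.1 _ m1.1 h01
      · exact k _ m0.1 _ m2.1 (h01.trans h12)
      · exact k _ m1.1 _ m2.1 h12
    · intro i j hij
      have k := fun i hi j hj hij => key i hi j hj hij (b - z 0) (a - z 0) (by linarith)
        (by linarith) (by simpa using hba)
      fin_cases i <;> fin_cases j <;> simp at hij <;> simp [slopeFrom]
      · exact k _ m0.1 _ m1.1 h01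
      · exact k _ m0.1 _ m2.1 (h01.trans h12)
      · exact k _ m1.1 _ m2.1 h12
    · intro i; fin_cases i
      exacts [m0.2, m1.2, m2.2]
  -- Seen from an apex on the right, slopes decrease with height, so the segments are listed from
  -- the top down.
  · have neg (s u : ℝ) : s / (u - z 0) = -(s / (z 0 - u)) := by
      rw [← div_neg, neg_sub]
    refine g.not_separates_three P (κ := Real.pi) Real.sin_pi
      (p := ![!₂[a, t j2], !₂[a, t j1], !₂[a, t j0]])
      (q := ![!₂[b, t j2], !₂[b, t j1], !₂[b, t j0]]) ?_ ?_ ?_ ?_ ?_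
    · intro i; fin_cases i <;> simp <;> linarith
    · intro i; fin_cases i <;> simp <;> linarith
    · intro i j hij
      have k := fun i hi j hj hij => key i hi j hj hij (z 0 - b) (z 0 - a) (by linarith)
        (by linarith) (by simpa using hab)
      fin_cases i <;> fin_cases j <;> simp at hij <;> simp [slopeFrom] <;>
        rw [neg, neg, neg_lt_neg_iff]
      · exact k _ m1.1 _ m2.1 h12
      · exact k _ m0.1 _ m2.1 (h01.trans h12)
      · exact k _ m0.1 _ m1.1 h01
    · intro i j hij
      have k := fun i hi j hj hij => key i hi j hj hij (z 0 - a) (z 0 - b) (by linarith)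
        (by linarith) (by simpa using hba)
      fin_cases i <;> fin_cases j <;> simp at hij <;> simp [slopeFrom] <;>
        rw [neg, neg, neg_lt_neg_iff]
      · exact k _ m1.1 _ m2.1 h12
      · exact k _ m0.1 _ m2.1 (h01.trans h12)
      · exact k _ m0.1 _ m1.1 h01
    · intro i; fin_cases i
      exacts [m2.2, m1.2, m0.2]

open scoped Classical in
/-- Among more than `4k` indices, some index avoids `2k` sets with at most two elements each. -/
lemma exists_index_avoiding {k J : ℕ} (hJ : 4 * k < J) {p q : Fin k → ℕ → Prop}
    (hp : ∀ i, ((Finset.range J).filter (p i)).card ≤ 2)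
    (hq : ∀ i, ((Finset.range J).filter (q i)).card ≤ 2) :
    ∃ j < J, ∀ i, ¬ p i j ∧ ¬ q i j := by
  by_contra! hc
  have hsub : Finset.range J ⊆ (Finset.univ : Finset (Fin k)).biUnion fun i =>
      (Finset.range J).filter (p i) ∪ (Finset.range J).filter (q i) := by
    intro j hj
    obtain ⟨i, hi⟩ := hc j (Finset.mem_range.1 hj)
    simp only [Finset.mem_biUnion, Finset.mem_univ, true_and, Finset.mem_union, Finset.mem_filter]
    refine ⟨i, ?_⟩
    by_cases h : p i j
    · exact Or.inl ⟨hj, h⟩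
    · exact Or.inr ⟨hj, hi h⟩
  have h1 := Finset.card_le_card hsub
  have h2 : ((Finset.univ : Finset (Fin k)).biUnion fun i =>
      (Finset.range J).filter (p i) ∪ (Finset.range J).filter (q i)).card ≤ ∑ _i : Fin k, 4 := by
    refine Finset.card_biUnion_le.trans (Finset.sum_le_sum fun i _ => ?_)
    have hpi := hp i
    have hqi := hq i
    refine (Finset.card_union_le _ _).trans ?_
    convert Nat.add_le_add hpi hqi
  simp at h1 h2
  omega

/-- All vertices of `Q` except those in `own` are horizontally far from the vertical strip around
the abscissa `B`, and not too high or low. -/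
def FarFrom {N : ℕ} (Q : Polygon Plane (N + 1)) (own : Set (Fin (N + 1))) (B D : ℝ) : Prop :=
  ∀ v ∉ own, (Q v 0 ≤ B - 2 - D ∨ B + 8 + D ≤ Q v 0) ∧ -1 ≤ Q v 1 ∧ Q v 1 ≤ 6

/-- Each guard outside `own` spoils at most two levels of each of the two families, hence `4 * k` in
all; a further level remains that serves both families at once. -/
lemma FarFrom.exists_level {own : Set (Fin (N + 1))} {B D δ : ℝ} (h : FarFrom Q own B D)
    (hδ : 0 < δ) (hD : 0 < D) (hDδ : 96 < D * δ) {k J : ℕ} (hJ : 4 * k < J)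
    (g : Fin k → VertexGuard (N + 1)) {a b a' b' : ℝ} {t t' : ℕ → ℝ}
    (ht : ∀ i j, i < j → t i + δ ≤ t j) (ht' : ∀ i j, i < j → t' i + δ ≤ t' j)
    (hJt : ∀ j < J, t j ∈ Icc 0 5) (hJt' : ∀ j < J, t' j ∈ Icc 0 5)
    (ha : a ∈ Icc (B - 2) (B + 8)) (hb : b ∈ Icc (B - 2) (B + 8))
    (ha' : a' ∈ Icc (B - 2) (B + 8)) (hb' : b' ∈ Icc (B - 2) (B + 8)) :
    ∃ j < J, ∀ i, (g i).vertex ∉ own →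
      ¬ ((!₂[a, t j] : Plane) ∈ (g i).region Q ∧ (!₂[b, t j] : Plane) ∉ (g i).region Q) ∧
      ¬ ((!₂[a', t' j] : Plane) ∈ (g i).region Q ∧ (!₂[b', t' j] : Plane) ∉ (g i).region Q) := by
  classical
  have main (i : Fin k) {a b : ℝ} {t : ℕ → ℝ} (ht : ∀ i j, i < j → t i + δ ≤ t j)
      (hJt : ∀ j < J, t j ∈ Icc 0 5)
      (ha : a ∈ Icc (B - 2) (B + 8)) (hb : b ∈ Icc (B - 2) (B + 8)) :
      ((Finset.range J).filter fun j => (g i).vertex ∉ own ∧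
        ((!₂[a, t j] : Plane) ∈ (g i).region Q ∧ (!₂[b, t j] : Plane) ∉ (g i).region Q)).card
        ≤ 2 := by
    by_cases hv : (g i).vertex ∈ own
    · simp [hv]
    · obtain ⟨hx, h1, h2⟩ := h _ hv
      simp only [hv, not_false_eq_true, true_and]
      have := (g i).card_separated_le Q (a := a) (b := b) (t := t) (J := J) hδ ht hD hDδ
        (abs_le.2 ⟨by linarith [ha.1, hb.2], by linarith [ha.2, hb.1]⟩)
        (fun j hj => abs_le.2 ⟨by linarith [(hJt j hj).1], by linarith [(hJt j hj).2]⟩)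
        (hx.imp (fun c => ⟨by linarith [ha.1], by linarith [hb.1]⟩)
          (fun c => ⟨by linarith [ha.2], by linarith [hb.2]⟩))
      convert this
  obtain ⟨j, hj, hj'⟩ := exists_index_avoiding hJ
    (p := fun i j => (g i).vertex ∉ own ∧
      ((!₂[a, t j] : Plane) ∈ (g i).region Q ∧ (!₂[b, t j] : Plane) ∉ (g i).region Q))
    (q := fun i j => (g i).vertex ∉ own ∧
      ((!₂[a', t' j] : Plane) ∈ (g i).region Q ∧ (!₂[b', t' j] : Plane) ∉ (g i).region Q))
    (fun i => by convert main i ht hJt ha hb) (fun i => by convert main i ht' hJt' ha' hb')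
  exact ⟨j, hj, fun i hi => ⟨fun c => (hj' i).1 ⟨hi, c⟩, fun c => (hj' i).2 ⟨hi, c⟩⟩⟩

/-- A point is outside a polygon if it is neither inside nor on the boundary. -/
def Outside {n : ℕ} (P : Polygon Plane n) (x : Plane) : Prop :=
  x ∉ P.boundary ℝ ∧ x ∉ inside P

/-- If horizontal segments from inside to outside occur near the abscissa `B`, then some guard is
stationed near `B`. -/
lemma FarFrom.exists_own {own : Set (Fin (N + 1))} {B D δ : ℝ} (h : FarFrom Q own B D)
    (hδ : 0 < δ) (hD : 0 < D) (hDδ : 96 < D * δ) {k J : ℕ} (hJ : 4 * k < J)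
    {g : Fin k → VertexGuard (N + 1)} (hg : Localizes g Q) {a b τ₀ : ℝ}
    (ha : a ∈ Icc (B - 2) (B + 8)) (hb : b ∈ Icc (B - 2) (B + 8))
    (hτ₀ : 0 ≤ τ₀) (hτ₀' : τ₀ + δ * J ≤ 5)
    (hin : ∀ τ ∈ Icc τ₀ (τ₀ + δ * J), (!₂[a, τ] : Plane) ∈ inside Q)
    (hout : ∀ τ ∈ Icc τ₀ (τ₀ + δ * J), Outside Q !₂[b, τ]) :
    ∃ i, (g i).vertex ∈ own := by
  have ht : ∀ i j : ℕ, i < j → (τ₀ + δ * i) + δ ≤ τ₀ + δ * j := by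
    intro i j hij
    have : (i : ℝ) + 1 ≤ j := by exact_mod_cast hij
    nlinarith
  have hJt : ∀ j < J, τ₀ + δ * j ∈ Icc τ₀ (τ₀ + δ * J) := by
    intro j hj
    have : (j : ℝ) ≤ J := by exact_mod_cast hj.le
    constructor
    · have : 0 ≤ δ * j := by positivity
      linarith
    · gcongr
  have hJt' : ∀ j < J, τ₀ + δ * j ∈ Icc 0 5 := fun j hj =>
    ⟨hτ₀.trans (hJt j hj).1, (hJt j hj).2.trans hτ₀'⟩
  obtain ⟨j, hj, hsep⟩ := h.exists_level hδ hD hDδ hJ g ht ht hJt' hJt' ha hb ha hb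
  obtain ⟨i, hi⟩ := hg.exists_separating (hin _ (hJt j hj)) (hout _ (hJt j hj)).1
    (hout _ (hJt j hj)).2
  by_contra! hc
  exact (hsep i (hc i)).1 hi

/-- Suppose that on rays from the vertex `A` near the abscissa `B` there are both inside points
`A + s • (ω, τ)` and outside points `A + t • (ω, τ)`, and that there are points of the opposite
kind at the same heights. Then a single guard at `A` is not the only one near `B`. -/
lemma FarFrom.two_own {own : Set (Fin (N + 1))} {B D δ : ℝ} (h : FarFrom Q own B D)
    (hδ : 0 < δ) (hD : 0 < D) (hDδ : 96 < D * δ) {k J : ℕ} (hJ : 4 * k < J)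
    {g : Fin k → VertexGuard (N + 1)} (hg : Localizes g Q) {A : Fin (N + 1)}
    (hA : ∀ i, (g i).vertex ∈ own → (g i).vertex = A)
    (hone : ∀ i j, (g i).vertex ∈ own → (g j).vertex ∈ own → i = j)
    {s t ω a b τ₀ : ℝ} (hs : 1 ≤ s) (ht : 1 ≤ t)
    (hsB : Q A 0 + s * ω ∈ Icc (B - 2) (B + 8)) (htB : Q A 0 + t * ω ∈ Icc (B - 2) (B + 8))
    (ha : a ∈ Icc (B - 2) (B + 8)) (hb : b ∈ Icc (B - 2) (B + 8))
    (hrange : ∀ τ ∈ Icc τ₀ (τ₀ + δ * J), Q A 1 + s * τ ∈ Icc 0 5 ∧ Q A 1 + t * τ ∈ Icc 0 5)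
    (hxin : ∀ τ ∈ Icc τ₀ (τ₀ + δ * J), (!₂[Q A 0 + s * ω, Q A 1 + s * τ] : Plane) ∈ inside Q)
    (hxout : ∀ τ ∈ Icc τ₀ (τ₀ + δ * J), Outside Q !₂[a, Q A 1 + s * τ])
    (hyout : ∀ τ ∈ Icc τ₀ (τ₀ + δ * J), Outside Q !₂[Q A 0 + t * ω, Q A 1 + t * τ])
    (hyin : ∀ τ ∈ Icc τ₀ (τ₀ + δ * J), (!₂[b, Q A 1 + t * τ] : Plane) ∈ inside Q) : False := by
  -- Scaling by a factor of at least 1 keeps the levels at least `δ` apart; hence the hypotheses on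
  -- `s` and `t`.
  have hlev : ∀ r : ℝ, 1 ≤ r → ∀ i j : ℕ, i < j →
      (Q A 1 + r * (τ₀ + δ * i)) + δ ≤ Q A 1 + r * (τ₀ + δ * j) := by
    intro r hr i j hij
    have h1 : (i : ℝ) + 1 ≤ j := by exact_mod_cast hij
    have h2 : δ * i + δ ≤ δ * j := by nlinarith
    nlinarith
  have hJt : ∀ j < J, τ₀ + δ * j ∈ Icc τ₀ (τ₀ + δ * J) := by
    intro j hj
    have : (j : ℝ) ≤ J := by exact_mod_cast hj.le
    constructor
    · have : 0 ≤ δ * j := by positivity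
      linarith
    · gcongr
  obtain ⟨j, hj, hsep⟩ := h.exists_level hδ hD hDδ hJ g (hlev s hs) (hlev t ht)
    (fun j hj => (hrange _ (hJt j hj)).1) (fun j hj => (hrange _ (hJt j hj)).2) hsB ha hb htB
  set τ := τ₀ + δ * j
  have hτ : τ ∈ Icc τ₀ (τ₀ + δ * J) := hJt j hj
  obtain ⟨i, hi⟩ := hg.exists_separating (hxin τ hτ) (hxout τ hτ).1 (hxout τ hτ).2
  obtain ⟨i', hi'⟩ := hg.exists_separating (hyin τ hτ) (hyout τ hτ).1 (hyout τ hτ).2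
  have hio : (g i).vertex ∈ own := by
    by_contra c
    exact (hsep i c).1 hi
  have hio' : (g i').vertex ∈ own := by
    by_contra c
    exact (hsep i' c).2 hi'
  -- The lone near guard performs both separations, so it receives the inside point of the ray and
  -- rejects the outside point of the same ray.
  obtain rfl := hone i i' hio hio'
  have ray (r : ℝ) : (!₂[Q A 0 + r * ω, Q A 1 + r * τ] : Plane) =
      Q (g i).vertex + r • !₂[ω, τ] := by
    rw [hA i hio]
    apply plane_ext <;> simp
  have h1 := hi.1
  have h2 := hi'.2
  rw [ray] at h1 h2
  exact h2 ((g i).mem_region_of_ray Q (by linarith) (by linarith) h1)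

/-! ### The staircase polygon and its perturbations -/

/-- The horizontal distance between consecutive steps of the staircase. -/
noncomputable def spacing (N : ℕ) : ℝ := 10000 * (4 * N + 5)

/-- Abscissas of the staircase polygon: groups of three vertices, at distance `1` within a group. -/
noncomputable def stairX (N j : ℕ) : ℝ := spacing N * ((j + 2) / 3 : ℕ) + ((j + 2) % 3 : ℕ)

/-- Ordinates of the staircase polygon: `0, 2, 1` in each group, but `5` at both ends. -/
noncomputable def stairY (N j : ℕ) : ℝ :=
  if j = 0 ∨ j = N then 5 else if (j + 2) % 3 = 0 then 0 else if (j + 2) % 3 = 1 then 2 else 1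

/-- A polygon whose vertices are close to those of the staircase polygon. -/
structure NearStair {N : ℕ} (Q : Polygon Plane (N + 1)) (X Y : ℕ → ℝ) : Prop where
  two_le : 2 ≤ N
  coord : ∀ i : Fin (N + 1), Q i = !₂[X i, Y i]
  abs_x : ∀ j ≤ N, |X j - stairX N j| ≤ 1 / 100
  abs_y : ∀ j ≤ N, |Y j - stairY N j| ≤ 1 / 100

lemma spacing_ge (N : ℕ) : 50000 ≤ spacing N := by
  unfold spacing
  have : (0 : ℝ) ≤ N := Nat.cast_nonneg N
  linarith

lemma NearStair.x_bounds (h : NearStair Q X Y) {j c r : ℕ} (hj : j ≤ N) (e : j + 2 = 3 * c + r)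
    (hr : r < 3) : X j ∈ Icc (spacing N * c + r - 1 / 100) (spacing N * c + r + 1 / 100) := by
  have := abs_le.1 (h.abs_x j hj)
  rw [stairX, show (j + 2) / 3 = c by omega, show (j + 2) % 3 = r by omega] at this
  constructor <;> linarith [this.1, this.2]

lemma NearStair.y_end (h : NearStair Q X Y) {j : ℕ} (hj : j = 0 ∨ j = N) :
    Y j ∈ Icc (5 - 1 / 100) (5 + 1 / 100 : ℝ) := by
  have := abs_le.1 (h.abs_y j (by omega))
  rw [stairY, if_pos hj] at this
  constructor <;> linarith [this.1, this.2]

lemma NearStair.y_bounds (h : NearStair Q X Y) {j : ℕ} (h0 : j ≠ 0) (h1 : j < N) :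
    ((j + 2) % 3 = 0 → Y j ∈ Icc (0 - 1 / 100) (0 + 1 / 100 : ℝ)) ∧
    ((j + 2) % 3 = 1 → Y j ∈ Icc (2 - 1 / 100) (2 + 1 / 100 : ℝ)) ∧
    ((j + 2) % 3 = 2 → Y j ∈ Icc (1 - 1 / 100) (1 + 1 / 100 : ℝ)) := by
  have := abs_le.1 (h.abs_y j h1.le)
  rw [stairY, if_neg (by omega)] at this
  refine ⟨fun c => ?_, fun c => ?_, fun c => ?_⟩ <;> simp [c] at this <;>
    constructor <;> linarith [this.1, this.2]

lemma NearStair.y_range (h : NearStair Q X Y) {j : ℕ} (hj : j ≤ N) : -1 ≤ Y j ∧ Y j ≤ 6 := by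
  by_cases h0 : j = 0 ∨ j = N
  · have := h.y_end h0
    constructor <;> linarith [this.1, this.2]
  · obtain ⟨a, b, c⟩ := h.y_bounds (j := j) (by omega) (by omega)
    rcases (show (j + 2) % 3 = 0 ∨ (j + 2) % 3 = 1 ∨ (j + 2) % 3 = 2 by omega) with e | e | e
    · have := a e; constructor <;> linarith [this.1, this.2]
    · have := b e; constructor <;> linarith [this.1, this.2]
    · have := c e; constructor <;> linarith [this.1, this.2]

lemma NearStair.step (h : NearStair Q X Y) {j : ℕ} (hj : j < N) : X j < X (j + 1) := by
  have hM := spacing_ge N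
  obtain ⟨c, r, hr, e⟩ : ∃ c r, r < 3 ∧ j + 2 = 3 * c + r :=
    ⟨(j + 2) / 3, (j + 2) % 3, Nat.mod_lt _ (by omega), (Nat.div_add_mod _ _).symm⟩
  have h1 := h.x_bounds hj.le e hr
  by_cases h2 : r = 2
  · have h3 := h.x_bounds (j := j + 1) (c := c + 1) (r := 0) hj (by omega) (by omega)
    subst h2
    push_cast at h1 h3
    linarith [h1.2, h3.1]
  · have h3 := h.x_bounds (j := j + 1) (c := c) (r := r + 1) hj (by omega) (by omega)
    push_cast at h1 h3
    linarith [h1.2, h3.1]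

lemma NearStair.strict (h : NearStair Q X Y) {i j : ℕ} (hij : i < j) (hj : j ≤ N) : X i < X j := by
  induction j, hij using Nat.le_induction with
  | base => exact h.step hj
  | succ k hk ih => exact (ih (by omega)).trans (h.step hj)

lemma NearStair.lid (h : NearStair Q X Y) {x : ℝ} (h0 : X 0 ≤ x) (h1 : x ≤ X N) :
    4.9 ≤ chord X Y 0 N x := by
  have hs := h.strict (i := 0) (j := N) (by have := h.two_le; omega) le_rfl
  have a := h.y_end (Or.inl rfl)
  have b := h.y_end (Or.inr rfl)
  have e : chord X Y 0 N x = ((X N - x) * Y 0 + (x - X 0) * Y N) / (X N - X 0) := by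
    have : X N - X 0 ≠ 0 := by linarith
    unfold chord
    field_simp
    ring
  rw [e, le_div_iff₀ (by linarith)]
  nlinarith [mul_nonneg (sub_nonneg.2 h0) (sub_nonneg.2 b.1),
    mul_nonneg (sub_nonneg.2 h1) (sub_nonneg.2 a.1)]

lemma NearStair.isLidded (h : NearStair Q X Y) : IsLidded Q X Y := by
  refine ⟨h.two_le, h.coord, fun i hi => h.step hi, fun i h0 h1 => ?_⟩
  have hl := h.lid (h.strict h0 h1.le).le (h.strict h1 le_rfl).le
  obtain ⟨a, b, c⟩ := h.y_bounds (by omega) h1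
  rcases (show (i + 2) % 3 = 0 ∨ (i + 2) % 3 = 1 ∨ (i + 2) % 3 = 2 by omega) with e | e | e
  · linarith [(a e).2]
  · linarith [(b e).2]
  · linarith [(c e).2]

/-- The edges between consecutive groups are almost horizontal. -/
lemma NearStair.abs_slope_le (h : NearStair Q X Y) {j c : ℕ} (hj : j < N) (e : j + 2 = 3 * c + 2) :
    |(Y (j + 1) - Y j) / (X (j + 1) - X j)| ≤ 1 / 1000 := by
  have hM := spacing_ge N
  have h1 := h.x_bounds hj.le e (by omega)
  have h3 := h.x_bounds (j := j + 1) (c := c + 1) (r := 0) hj (by omega) (by omega)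
  push_cast at h1 h3
  have hd : 40000 ≤ X (j + 1) - X j := by linarith [h1.2, h3.1]
  have y1 := h.y_range hj.le
  have y2 := h.y_range (j := j + 1) hj
  rw [abs_div, abs_of_pos (show 0 < X (j + 1) - X j by linarith), div_le_iff₀ (by linarith)]
  rw [abs_le]
  constructor <;> linarith

lemma NearStair.polyline_near_left (h : NearStair Q X Y) {j c : ℕ} (hj : j < N)
    (e : j + 2 = 3 * c + 2) {x : ℝ} (h0 : X j ≤ x) (h1 : x ≤ X (j + 1)) (h2 : x ≤ X j + 10) :
    |polyline X Y N x - Y j| ≤ 1 / 100 := by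
  rw [h.isLidded.polyline_eq hj h0 h1, chord, add_sub_cancel_left, abs_mul,
    abs_of_nonneg (sub_nonneg.2 h0)]
  have := h.abs_slope_le hj e
  have h3 : x - X j ≤ 10 := by linarith
  calc _ ≤ (1 / 1000 : ℝ) * 10 := by gcongr
    _ = 1 / 100 := by norm_num

lemma NearStair.polyline_near_right (h : NearStair Q X Y) {j c : ℕ} (hj : j < N)
    (e : j + 2 = 3 * c + 2) {x : ℝ} (h0 : X j ≤ x) (h1 : x ≤ X (j + 1)) (h2 : X (j + 1) ≤ x + 10) :
    |polyline X Y N x - Y (j + 1)| ≤ 1 / 100 := by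
  have hs := h.step hj
  have e2 : chord X Y j (j + 1) x - Y (j + 1) =
      (Y (j + 1) - Y j) / (X (j + 1) - X j) * -(X (j + 1) - x) := by
    have : X (j + 1) - X j ≠ 0 := by linarith
    unfold chord
    field_simp
    ring
  rw [h.isLidded.polyline_eq hj h0 h1, e2, abs_mul, abs_neg, abs_of_nonneg (sub_nonneg.2 h1)]
  have := h.abs_slope_le hj e
  have h3 : X (j + 1) - x ≤ 10 := by linarith
  calc _ ≤ (1 / 1000 : ℝ) * 10 := by gcongr
    _ = 1 / 100 := by norm_num

/-! ### Inside and outside points near a group -/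

/-- The long edge arriving at the group is already near height 0 here. This also holds for an
incomplete last group, as long as its first vertex is not the end of the lid. -/
lemma NearStair.inside_left {i c : ℕ} (h : NearStair Q X Y) (hc : i + 2 = 3 * c)
    (hi : i ≠ 0) (hN : i + 1 ≤ N) {x y : ℝ}
    (hx : x ∈ Icc (spacing N * c - 1.1) (spacing N * c - 0.9)) (hy : y ∈ Ioo 0.1 4.9) :
    (!₂[x, y] : Plane) ∈ inside Q := by
  have hM := spacing_ge N
  have e : i - 1 + 1 = i := by omega
  have h1 := h.x_bounds (j := i) (c := c) (r := 0) (by omega) (by omega) (by omega)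
  have h2 := h.x_bounds (j := i - 1) (c := c - 1) (r := 2) (by omega) (by omega) (by omega)
  rw [Nat.cast_sub (by omega)] at h2
  push_cast at h1 h2
  have a1 : X (i - 1) ≤ x := by nlinarith [h2.2, hx.1]
  have a2 : x ≤ X i := by linarith [h1.1, hx.2]
  have h3 := h.polyline_near_right (j := i - 1) (c := c - 1) (x := x) (by omega) (by omega) a1
    (by rw [e]; exact a2) (by rw [e]; linarith [h1.2, hx.1])
  rw [e] at h3
  have h4 := ((h.y_bounds hi (by omega)).1 (by omega)).2
  have b1 : X 0 < x := (h.isLidded.mono (Nat.zero_le _) (by omega)).trans_lt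
    (show X (i - 1) < x by nlinarith [h2.2, hx.1])
  have b2 : x < X N := a2.trans_lt (h.strict (by omega) le_rfl)
  have h5 := h.lid b1.le b2.le
  refine h.isLidded.mem_inside b1 b2 ?_ ?_
  · have := (abs_le.1 h3).2
    show polyline X Y N x < y
    linarith [hy.1]
  · show y < chord X Y 0 N x
    linarith [hy.2]

/-- The point is below the rising edge from `i` to `i + 1`. If `i + 1 = N`, that edge ends near
height 5 and is only steeper. -/
lemma NearStair.outside_half {i c : ℕ} (h : NearStair Q X Y) (hc : i + 2 = 3 * c)
    (hi : i ≠ 0) (hN : i + 1 ≤ N) {x y : ℝ}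
    (hx : x = spacing N * c + 0.5) (hy : y ≤ 0.7) : Outside Q (!₂[x, y] : Plane) := by
  have h1 := h.x_bounds (j := i) (c := c) (r := 0) (by omega) (by omega) (by omega)
  have h2 := h.x_bounds (j := i + 1) (c := c) (r := 1) (by omega) (by omega) (by omega)
  push_cast at h1 h2
  have h4 := ((h.y_bounds hi (by omega)).1 (by omega))
  have h5 : 1.99 ≤ Y (i + 1) := by
    by_cases hl : i + 1 = N
    · linarith [(h.y_end (Or.inr hl)).1]
    · have := ((h.y_bounds (j := i + 1) (by omega) (by omega)).2.1 (by omega)).1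
      linarith
  have a1 : X i ≤ x := by linarith [h1.2]
  have a2 : x ≤ X (i + 1) := by linarith [h2.1]
  refine h.isLidded.not_mem_of_lt ((h.isLidded.mono (Nat.zero_le _) (by omega)).trans a1)
    (a2.trans (h.isLidded.mono hN le_rfl)) ?_
  show y < polyline X Y N x
  rw [h.isLidded.polyline_eq (by omega) a1 a2, chord]
  have hs : 1.9 ≤ (Y (i + 1) - Y i) / (X (i + 1) - X i) := by
    rw [le_div_iff₀ (by linarith [h1.2, h2.1])]
    linarith [h1.1, h2.2, h4.2]
  have hd : 0.49 ≤ x - X i := by linarith [h1.2]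
  have : 1.9 * 0.49 ≤ (Y (i + 1) - Y i) / (X (i + 1) - X i) * (x - X i) := by gcongr
  linarith [h4.1]

/-- The middle vertex is near height 2, and the chain falls from it with slopes of about 2 on the
left and 1 on the right, too little to reach 1.7 in this strip. -/
lemma NearStair.outside_spike {i c : ℕ} (h : NearStair Q X Y) (hc : i + 2 = 3 * c)
    (hi : i ≠ 0) (hN : i + 2 < N) {x y : ℝ}
    (hx : x ∈ Icc (spacing N * c + 0.9) (spacing N * c + 1.1)) (hy : y ≤ 1.7) :
    Outside Q (!₂[x, y] : Plane) := by
  have h1 := h.x_bounds (j := i) (c := c) (r := 0) (by omega) (by omega) (by omega)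
  have h2 := h.x_bounds (j := i + 1) (c := c) (r := 1) (by omega) (by omega) (by omega)
  have h3 := h.x_bounds (j := i + 2) (c := c) (r := 2) (by omega) (by omega) (by omega)
  push_cast at h1 h2 h3
  have y1 := (h.y_bounds (j := i) hi (by omega)).1 (by omega)
  have y2 := (h.y_bounds (j := i + 1) (by omega) (by omega)).2.1 (by omega)
  have y3 := (h.y_bounds (j := i + 2) (by omega) (by omega)).2.2 (by omega)
  have a1 : X i ≤ x := by linarith [h1.2, hx.1]
  have a2 : x ≤ X (i + 2) := by linarith [h3.1, hx.2]
  refine h.isLidded.not_mem_of_lt ((h.isLidded.mono (Nat.zero_le _) (by omega)).trans a1)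
    (a2.trans (h.isLidded.mono (by omega) le_rfl)) ?_
  show y < polyline X Y N x
  rcases le_total x (X (i + 1)) with a3 | a3
  · rw [h.isLidded.polyline_eq (by omega) a1 a3]
    have e : chord X Y i (i + 1) x = Y (i + 1) -
        (Y (i + 1) - Y i) / (X (i + 1) - X i) * (X (i + 1) - x) := by
      have : X (i + 1) - X i ≠ 0 := by linarith [h1.2, h2.1]
      unfold chord
      field_simp
      ring
    have hs : (Y (i + 1) - Y i) / (X (i + 1) - X i) ≤ 2.1 := by
      rw [div_le_iff₀ (by linarith [h1.2, h2.1])]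
      linarith [h1.2, h2.1, y1.1, y2.2]
    have hd : X (i + 1) - x ≤ 0.11 := by linarith [h2.2, hx.1]
    have : (Y (i + 1) - Y i) / (X (i + 1) - X i) * (X (i + 1) - x) ≤ 2.1 * 0.11 := by
      gcongr
    linarith [y2.1]
  · rw [h.isLidded.polyline_eq (by omega) a3 a2, chord]
    have hs : -1.1 ≤ (Y (i + 1 + 1) - Y (i + 1)) / (X (i + 1 + 1) - X (i + 1)) := by
      rw [le_div_iff₀ (by linarith [h2.2, h3.1])]
      linarith [h2.2, h3.1, y2.2, y3.1]
    have hd : x - X (i + 1) ≤ 0.11 := by linarith [h2.1, hx.2]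
    nlinarith [y2.1]

lemma NearStair.polyline_right {i c : ℕ} (h : NearStair Q X Y) (hc : i + 2 = 3 * c)
    (hN : i + 2 < N) {x : ℝ}
    (hx : x ∈ Icc (spacing N * c + 2.1) (spacing N * c + 8)) :
    X 0 < x ∧ x < X N ∧ polyline X Y N x ∈ Icc 0.9 1.1 := by
  have hM := spacing_ge N
  have h3 := h.x_bounds (j := i + 2) (c := c) (r := 2) (by omega) (by omega) (by omega)
  have h4 := h.x_bounds (j := i + 2 + 1) (c := c + 1) (r := 0) (by omega) (by omega) (by omega)
  push_cast at h3 h4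
  have y3 := (h.y_bounds (j := i + 2) (by omega) (by omega)).2.2 (by omega)
  have a1 : X (i + 2) < x := by linarith [h3.2, hx.1]
  have a2 : x < X (i + 2 + 1) := by linarith [h4.1, hx.2]
  have := abs_le.1 (h.polyline_near_left (j := i + 2) (c := c) (by omega) (by omega) a1.le a2.le
    (by linarith [h3.1, hx.2]))
  refine ⟨(h.isLidded.mono (Nat.zero_le _) (by omega)).trans_lt a1,
    a2.trans_le (h.isLidded.mono (by omega) le_rfl), ?_, ?_⟩
  · linarith [y3.1, this.1]
  · linarith [y3.2, this.2]

lemma NearStair.inside_right {i c : ℕ} (h : NearStair Q X Y) (hc : i + 2 = 3 * c)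
    (hN : i + 2 < N) {x y : ℝ}
    (hx : x ∈ Icc (spacing N * c + 2.1) (spacing N * c + 8)) (hy : y ∈ Ioo 1.1 4.9) :
    (!₂[x, y] : Plane) ∈ inside Q := by
  obtain ⟨b1, b2, b3⟩ := h.polyline_right hc hN hx
  exact h.isLidded.mem_inside b1 b2 (b3.2.trans_lt hy.1) (hy.2.trans_le (h.lid b1.le b2.le))

lemma NearStair.outside_right {i c : ℕ} (h : NearStair Q X Y) (hc : i + 2 = 3 * c)
    (hN : i + 2 < N) {x y : ℝ}
    (hx : x ∈ Icc (spacing N * c + 2.1) (spacing N * c + 8)) (hy : y < 0.9) :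
    Outside Q (!₂[x, y] : Plane) := by
  obtain ⟨b1, b2, b3⟩ := h.polyline_right hc hN hx
  exact h.isLidded.not_mem_of_lt b1.le b2.le (hy.trans_le b3.1)

/-! ### Guards needed by each group, and the count -/

/-- The vertices of the `c`-th group of the staircase. -/
def group (N c : ℕ) : Set (Fin (N + 1)) := {v | ((v : ℕ) + 2) / 3 = c}

/-- The loss of 20 absorbs the offsets within groups, the margins of the strip and the perturbation.
-/
lemma NearStair.farFrom (h : NearStair Q X Y) (c : ℕ) :
    FarFrom Q (group N c) (spacing N * c) (spacing N - 20) := by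
  intro v hv
  have hv' : ((v : ℕ) + 2) / 3 ≠ c := hv
  have hM := spacing_ge N
  have hL := h.isLidded
  have hb := h.x_bounds (j := v) (c := (v + 2) / 3) (r := (v + 2) % 3) (by omega) (by omega)
    (by omega)
  have hr : (((v + 2) % 3 : ℕ) : ℝ) ≤ 2 := by
    exact_mod_cast (show ((v : ℕ) + 2) % 3 ≤ 2 by omega)
  have hr0 : (0 : ℝ) ≤ (((v + 2) % 3 : ℕ) : ℝ) := Nat.cast_nonneg _
  rw [hL.coord_zero, hL.coord_one]
  refine ⟨?_, h.y_range (by omega)⟩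
  rcases lt_or_gt_of_ne hv' with hlt | hlt
  · left
    have : ((((v : ℕ) + 2) / 3 : ℕ) : ℝ) + 1 ≤ c := by exact_mod_cast hlt
    nlinarith [hb.2]
  · right
    have : (c : ℝ) + 1 ≤ ((((v : ℕ) + 2) / 3 : ℕ) : ℝ) := by exact_mod_cast hlt
    nlinarith [hb.1]

/-- The vertical distance between test segments. -/
noncomputable def gapSize (N : ℕ) : ℝ := 1 / (25 * (4 * N + 5))

lemma gapSize_pos (N : ℕ) : 0 < gapSize N := by unfold gapSize; positivity

/-- There are `4 * N + 5` levels, more than four times the number of guards, and they fit in a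
window of 0.04, narrow enough for all to share the same inside and outside estimates. -/
lemma gapSize_mul (N : ℕ) : gapSize N * ((4 * N + 5 : ℕ) : ℝ) = 0.04 := by
  unfold gapSize; push_cast; field_simp; norm_num

/-- The product of `spacing N` and `gapSize N` is 400 for every `N`, which leaves ample room above
96. -/
lemma lt_spacing_mul_gapSize (N : ℕ) : 96 < (spacing N - 20) * gapSize N := by
  have : (0 : ℝ) ≤ N := Nat.cast_nonneg N
  unfold gapSize spacing
  rw [mul_one_div, lt_div_iff₀ (by positivity)]
  linarith

/-- Near height 0.5 one is inside one unit to the left of the group and outside below its rising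
edge. -/
lemma NearStair.exists_own (h : NearStair Q X Y) {k : ℕ} (hk : k ≤ N)
    {g : Fin k → VertexGuard (N + 1)} (hg : Localizes g Q) {i c : ℕ} (hc : i + 2 = 3 * c)
    (hi : i ≠ 0) (hN : i + 1 ≤ N) : ∃ j, (g j).vertex ∈ group N c := by
  have hM := spacing_ge N
  refine (h.farFrom c).exists_own (gapSize_pos N) (by linarith) (lt_spacing_mul_gapSize N)
    (J := 4 * N + 5) (by omega) hg (a := spacing N * c - 1) (b := spacing N * c + 0.5) (τ₀ := 0.5)
    ⟨by linarith, by linarith⟩ ⟨by linarith, by linarith⟩ (by norm_num) ?_ ?_ ?_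
  all_goals rw [gapSize_mul]
  · norm_num
  · rintro τ ⟨h1, h2⟩
    exact h.inside_left hc hi hN ⟨by linarith, by linarith⟩ ⟨by linarith, by linarith⟩
  · rintro τ ⟨h1, h2⟩
    exact h.outside_half hc hi hN rfl (by linarith)

lemma NearStair.two_own (h : NearStair Q X Y) {k : ℕ} (hk : k ≤ N)
    {g : Fin k → VertexGuard (N + 1)} (hg : Localizes g Q) {i c : ℕ} (hc : i + 2 = 3 * c)
    (hi : i ≠ 0) (hN : i + 2 < N) :
    ∃ j j', j ≠ j' ∧ (g j).vertex ∈ group N c ∧ (g j').vertex ∈ group N c := by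
  by_contra! hone'
  have hone : ∀ j j', (g j).vertex ∈ group N c → (g j').vertex ∈ group N c → j = j' := by
    intro j j' h1 h2
    by_contra hne
    exact hone' j j' hne h1 h2
  have hM := spacing_ge N
  have hL := h.isLidded
  obtain ⟨j₀, hj₀⟩ := h.exists_own hk hg hc hi (by omega)
  have hA : ∀ j, (g j).vertex ∈ group N c → (g j).vertex = (g j₀).vertex := fun j hj => by
    rw [hone j j₀ hj hj₀]
  have core := fun s t ω a b τ₀ : ℝ => (h.farFrom c).two_own (s := s) (t := t) (ω := ω) (a := a)
    (b := b) (τ₀ := τ₀) (gapSize_pos N) (by linarith) (lt_spacing_mul_gapSize N)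
    (J := 4 * N + 5) (by omega) hg hA hone
  have hv : (((g j₀).vertex : ℕ) + 2) / 3 = c := hj₀
  rw [hL.coord_zero, hL.coord_one, gapSize_mul] at core
  rcases (show ((g j₀).vertex : ℕ) = i ∨ ((g j₀).vertex : ℕ) = i + 1 ∨
    ((g j₀).vertex : ℕ) = i + 2 by omega) with e | e | e <;> rw [e] at core
  · have hx := h.x_bounds (j := i) (c := c) (r := 0) (by omega) (by omega) (by omega)
    have hy := (h.y_bounds (j := i) hi (by omega)).1 (by omega)
    push_cast at hx
    obtain ⟨x1, x2⟩ := hx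
    obtain ⟨y1, y2⟩ := hy
    -- Relative to the group's base point, the ray from near (0, 0) passes below the spike near (1,
    -- 0.5) and is inside near (3, 1.5). Here and below, the comparison points are at abscissa 1,
    -- under the spike, and at -1, inside.
    refine core 3 1 1 (spacing N * c + 1) (spacing N * c - 1) 0.48 (by norm_num) (by norm_num) ?_ ?_ ?_ ?_ ?_ ?_ ?_ ?_ ?_
    · constructor <;> linarith
    · constructor <;> linarith
    · constructor <;> linarith
    · constructor <;> linarith
    all_goals rintro τ ⟨h1, h2⟩
    · refine ⟨⟨?_, ?_⟩, ⟨?_, ?_⟩⟩ <;> linarith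
    · refine h.inside_right hc hN ⟨?_, ?_⟩ ⟨?_, ?_⟩ <;> linarith
    · refine h.outside_spike hc hi hN ⟨?_, ?_⟩ ?_ <;> linarith
    · refine h.outside_spike hc hi hN ⟨?_, ?_⟩ ?_ <;> linarith
    · refine h.inside_left hc hi (by omega) ⟨?_, ?_⟩ ⟨?_, ?_⟩ <;> linarith
  · have hx := h.x_bounds (j := i + 1) (c := c) (r := 1) (by omega) (by omega) (by omega)
    have hy := (h.y_bounds (j := i + 1) (by omega) (by omega)).2.1 (by omega)
    push_cast at hx
    obtain ⟨x1, x2⟩ := hx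
    obtain ⟨y1, y2⟩ := hy
    -- From near (1, 2) the descending ray is inside near (3, 1.5) and below the outgoing edge near
    -- (7, 0.5).
    refine core 2 6 1 (spacing N * c + 1) (spacing N * c - 1) (-0.27) (by norm_num) (by norm_num) ?_ ?_ ?_ ?_ ?_ ?_ ?_ ?_ ?_
    · constructor <;> linarith
    · constructor <;> linarith
    · constructor <;> linarith
    · constructor <;> linarith
    all_goals rintro τ ⟨h1, h2⟩
    · refine ⟨⟨?_, ?_⟩, ⟨?_, ?_⟩⟩ <;> linarith
    · refine h.inside_right hc hN ⟨?_, ?_⟩ ⟨?_, ?_⟩ <;> linarith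
    · refine h.outside_spike hc hi hN ⟨?_, ?_⟩ ?_ <;> linarith
    · refine h.outside_right hc hN ⟨?_, ?_⟩ ?_ <;> linarith
    · refine h.inside_left hc hi (by omega) ⟨?_, ?_⟩ ⟨?_, ?_⟩ <;> linarith
  · have hx := h.x_bounds (j := i + 2) (c := c) (r := 2) (by omega) (by omega) (by omega)
    have hy := (h.y_bounds (j := i + 2) (by omega) (by omega)).2.2 (by omega)
    push_cast at hx
    obtain ⟨x1, x2⟩ := hx
    obtain ⟨y1, y2⟩ := hy
    -- From near (2, 1) the ray to the left crosses the spike near (1, 1.2) and is inside near (-1,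
    -- 1.6).
    refine core 3 1 (-1) (spacing N * c + 1) (spacing N * c - 1) 0.18 (by norm_num) (by norm_num) ?_ ?_ ?_ ?_ ?_ ?_ ?_ ?_ ?_
    · constructor <;> linarith
    · constructor <;> linarith
    · constructor <;> linarith
    · constructor <;> linarith
    all_goals rintro τ ⟨h1, h2⟩
    · refine ⟨⟨?_, ?_⟩, ⟨?_, ?_⟩⟩ <;> linarith
    · refine h.inside_left hc hi (by omega) ⟨?_, ?_⟩ ⟨?_, ?_⟩ <;> linarith
    · refine h.outside_spike hc hi hN ⟨?_, ?_⟩ ?_ <;> linarith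
    · refine h.outside_spike hc hi hN ⟨?_, ?_⟩ ?_ <;> linarith
    · refine h.inside_left hc hi (by omega) ⟨?_, ?_⟩ ⟨?_, ?_⟩ <;> linarith

lemma NearStair.requires (h : NearStair Q X Y) :
    RequiresVertexGuards Q (2 * (N + 1) / 3 - 1) := by
  classical
  intro k g hg
  by_contra! hlt
  have hk : k ≤ N := by omega
  have h2 := h.two_le
  set f : Fin k → ℕ := fun j => ((g j).vertex + 2) / 3
  -- Group `c` counts as complete only if `3 * c < N`, because vertex `N` is raised to the lid.
  set m := (N - 1) / 3 with hm
  have hfull : ∀ c ∈ Finset.Icc 1 m, 2 ≤ (Finset.univ.filter fun j => f j = c).card := by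
    intro c hc
    rw [Finset.mem_Icc] at hc
    obtain ⟨j, j', hne, hj, hj'⟩ := h.two_own hk hg (i := 3 * c - 2) (c := c) (by omega) (by omega)
      (by omega)
    exact Finset.one_lt_card.2 ⟨j, Finset.mem_filter.2 ⟨Finset.mem_univ j, hj⟩, j',
      Finset.mem_filter.2 ⟨Finset.mem_univ j', hj'⟩, hne⟩
  have hsum : 2 * m ≤ (Finset.univ.filter fun j => f j ∈ Finset.Icc 1 m).card := by
    rw [Finset.card_eq_sum_card_fiberwise (f := f) (t := Finset.Icc 1 m)
      (fun j hj => by simpa using hj)]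
    calc 2 * m = ∑ _c ∈ Finset.Icc 1 m, 2 := by simp [mul_comm]
      _ ≤ _ := Finset.sum_le_sum fun c hc => (hfull c hc).trans (Finset.card_le_card ?_)
    intro j hj
    simp only [Finset.mem_filter, Finset.mem_univ, true_and] at hj ⊢
    exact ⟨hj ▸ hc, hj⟩
  -- If only vertex `N` is left over, `2 * m` is already the bound; otherwise group `m + 1` has two
  -- or three vertices and supplies the missing guard.
  by_cases hp : 3 * m + 1 = N
  · have := Finset.card_le_univ (Finset.univ.filter fun j => f j ∈ Finset.Icc 1 m)
    rw [Fintype.card_fin] at this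
    omega
  · obtain ⟨j, hj⟩ := h.exists_own hk hg (i := 3 * m + 1) (c := m + 1) (by omega) (by omega)
      (by omega)
    have hlt' : (Finset.univ.filter fun j => f j ∈ Finset.Icc 1 m).card <
        (Finset.univ : Finset (Fin k)).card := by
      refine Finset.card_lt_card (Finset.ssubset_univ_iff.2 fun e => ?_)
      have hmem : j ∈ Finset.univ.filter fun j => f j ∈ Finset.Icc 1 m := by
        rw [e]
        exact Finset.mem_univ j
      have hfj : f j = m + 1 := hj
      simp [hfj] at hmem
    rw [Finset.card_univ, Fintype.card_fin] at hlt'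
    omega

/-! ### Perturbation into general position -/

lemma volume_line_eq_zero (a b : Plane) : volume (line[ℝ, a, b] : Set Plane) = 0 := by
  apply Measure.addHaar_affineSubspace
  intro htop
  have h1 := (collinear_iff_finrank_le_one (k := ℝ) (s := {a, b})).1 (collinear_pair ℝ a b)
  rw [← direction_affineSpan, htop, AffineSubspace.direction_top, finrank_top,
    finrank_euclideanSpace_fin] at h1
  omega

/-- Finitely many points of the plane can be moved by arbitrarily small amounts so that no three
of them are collinear. -/
lemma exists_generalPosition {n : ℕ} (P : Fin n → Plane) {ε : ℝ} (hε : 0 < ε) :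
    ∃ P' : Fin n → Plane, (∀ i, dist (P' i) (P i) < ε) ∧
      ∀ i j k, i ≠ j → j ≠ k → i ≠ k → ¬ Collinear ℝ {P' i, P' j, P' k} := by
  suffices ∀ m ≤ n, ∃ P' : Fin n → Plane, (∀ i, dist (P' i) (P i) < ε) ∧
      (∀ i j : Fin n, (i : ℕ) < m → (j : ℕ) < m → i ≠ j → P' i ≠ P' j) ∧
      ∀ i j k : Fin n, (i : ℕ) < m → (j : ℕ) < m → (k : ℕ) < m → i ≠ j → j ≠ k → i ≠ k →
        ¬ Collinear ℝ {P' i, P' j, P' k} by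
    obtain ⟨P', h1, -, h3⟩ := this n le_rfl
    exact ⟨P', h1, fun i j k => h3 i j k i.2 j.2 k.2⟩
  intro m
  induction m with
  | zero => exact fun _ => ⟨P, by simp [hε], by simp, by simp⟩
  | succ m ih =>
    intro hm
    obtain ⟨P', h1, h2, h3⟩ := ih (by omega)
    set v : Fin n := ⟨m, hm⟩
    -- The points are moved one at a time, each off finitely many null lines. The degenerate lines
    -- with `i = j` also keep the new point distinct from the others.
    have hnull : volume (⋃ i, ⋃ j, (line[ℝ, P' i, P' j] : Set Plane)) = 0 :=
      measure_iUnion_null fun i => measure_iUnion_null fun j => volume_line_eq_zero _ _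
    obtain ⟨q, hq, hq'⟩ : ∃ q ∈ Metric.ball (P v) ε,
        q ∉ ⋃ i, ⋃ j, (line[ℝ, P' i, P' j] : Set Plane) := by
      by_contra! hc
      exact (Metric.measure_ball_pos volume (P v) hε).ne' (measure_mono_null hc hnull)
    simp only [mem_iUnion, not_exists, SetLike.mem_coe] at hq'
    have hne (i : Fin n) : q ≠ P' i := fun e => hq' i i (e ▸ left_mem_affineSpan_pair ℝ _ _)
    have hcol (i j : Fin n) (hi : (i : ℕ) < m) (hj : (j : ℕ) < m) (hij : i ≠ j) :
        ¬ Collinear ℝ {P' i, P' j, q} := fun hc =>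
      hq' i j (hc.mem_affineSpan_of_mem_of_ne (by simp) (by simp) (by simp) (h2 i j hi hj hij))
    have hlt (i : Fin n) (hi : (i : ℕ) < m + 1) (hiv : i ≠ v) : (i : ℕ) < m :=
      lt_of_le_of_ne (Nat.lt_succ_iff.1 hi) fun e => hiv (Fin.ext e)
    refine ⟨Function.update P' v q, fun i => ?_, fun i j hi hj hij => ?_,
      fun i j k hi hj hk hij hjk hik => ?_⟩
    · rcases eq_or_ne i v with rfl | hiv
      · simpa using hq
      · simpa [hiv] using h1 i
    · rcases eq_or_ne i v with rfl | hiv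
      · simpa [hij.symm] using hne j
      · rcases eq_or_ne j v with rfl | hjv
        · simpa [hij] using (hne i).symm
        · simpa [hiv, hjv] using h2 i j (hlt i hi hiv) (hlt j hj hjv) hij
    · rcases eq_or_ne i v with rfl | hiv
      · have := hcol j k (hlt j hj hij.symm) (hlt k hk hik.symm) hjk
        rw [Function.update_self, Function.update_of_ne hij.symm, Function.update_of_ne hik.symm]
        rwa [insert_comm, pair_comm q]
      · rcases eq_or_ne j v with rfl | hjv
        · have := hcol i k (hlt i hi hij) (hlt k hk hjk.symm) hik
          rw [Function.update_self, Function.update_of_ne hij, Function.update_of_ne hjk.symm]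
          rwa [pair_comm q]
        · rcases eq_or_ne k v with rfl | hkv
          · have := hcol i j (hlt i hi hik) (hlt j hj hjk) hij
            rwa [Function.update_self, Function.update_of_ne hik, Function.update_of_ne hjk]
          · rw [Function.update_of_ne hiv, Function.update_of_ne hjv, Function.update_of_ne hkv]
            exact h3 i j k (hlt i hi hiv) (hlt j hj hjv) (hlt k hk hkv) hij hjk hik

lemma exists_nearStair {N : ℕ} (hN : 2 ≤ N) {Q : Polygon Plane (N + 1)}
    (hQ : ∀ i : Fin (N + 1), dist (Q i) !₂[stairX N i, stairY N i] < 1 / 100) :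
    ∃ X Y : ℕ → ℝ, NearStair Q X Y := by
  refine ⟨fun i => if h : i < N + 1 then Q ⟨i, h⟩ 0 else 0,
    fun i => if h : i < N + 1 then Q ⟨i, h⟩ 1 else 0, hN, fun i => ?_, fun j hj => ?_, fun j hj => ?_⟩
  · apply plane_ext <;> simp <;> omega
  · have := (PiLp.norm_apply_le (Q ⟨j, by omega⟩ - !₂[stairX N j, stairY N j]) 0).trans
      (dist_eq_norm (Q ⟨j, by omega⟩) _ ▸ (hQ ⟨j, by omega⟩).le)
    simpa [Nat.lt_succ_of_le hj] using this
  · have := (PiLp.norm_apply_le (Q ⟨j, by omega⟩ - !₂[stairX N j, stairY N j]) 1).trans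
      (dist_eq_norm (Q ⟨j, by omega⟩) _ ▸ (hQ ⟨j, by omega⟩).le)
    simpa [Nat.lt_succ_of_le hj] using this

end WirelessLocalization

theorem theorem1 (n : ℕ) (hn : 3 ≤ n) :
    ∃ P : Polygon WirelessLocalization.Plane n,
      WirelessLocalization.IsSimple P ∧
      WirelessLocalization.InGeneralPosition P ∧
      ∃ ε : ℝ, 0 < ε ∧
        ∀ Q : Polygon WirelessLocalization.Plane n, (∀ i : Fin n, dist (Q i) (P i) < ε) →
          WirelessLocalization.IsSimple Q ∧
          WirelessLocalization.RequiresVertexGuards Q (2 * n / 3 - 1) := by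
  obtain ⟨N, rfl⟩ : ∃ N, n = N + 1 := ⟨n - 1, by omega⟩
  -- The exact staircase may have collinear vertices. Half of the tolerance `1 / 100` is spent on
  -- general position, the other half is left for `ε`.
  obtain ⟨P, hP, hgen⟩ := WirelessLocalization.exists_generalPosition
    (fun i : Fin (N + 1) => !₂[WirelessLocalization.stairX N i, WirelessLocalization.stairY N i])
    (ε := 1 / 200) (by norm_num)
  have main (Q : Polygon WirelessLocalization.Plane (N + 1))
      (hQ : ∀ i, dist (Q i) (P i) < 1 / 200) : WirelessLocalization.IsSimple Q ∧
      WirelessLocalization.RequiresVertexGuards Q (2 * (N + 1) / 3 - 1) := by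
    obtain ⟨X, Y, h⟩ := WirelessLocalization.exists_nearStair (Q := Q) (by omega) fun i =>
      (dist_triangle _ _ _).trans_lt ((add_lt_add (hQ i) (hP i)).trans_le (by norm_num))
    exact ⟨h.isLidded.isSimple, h.requires⟩
  exact ⟨⟨P⟩, (main ⟨P⟩ fun i => by simp).1, hgen, 1 / 200, by norm_num, main⟩
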